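/- Let $n\ge 1$ and let $\Gamma\cong\mathbb{Z}^n$ act freely, properly discontinuously and cocompactly by isometries on a length space $(X,d)$. For $\gamma\in\Gamma$ let $$\|\gamma\|_{st}=\lim_{k\to\infty}\frac1k\, d(x,\gamma^k x)$$ be its stable norm (the limit exists and does not depend on $x\in X$). Let $D$ be an upper bound for the codiameter of the action, that is, for the diameter of $\Gamma\backslash X$ with respect to the quotient distance $\bar d(\Gamma x,\Gamma y)=\inf_{\gamma\in\Gamma} d(x,\gamma y)$, and let $\Omega$ be an upper bound for the asymptotic volume $$\omega(\Gamma,d)=\lim_{R\to\infty}\frac{\#\{\gamma\in\Gamma : d(x,\gamma x)<R\}}{R^n},$$ which does not depend on $x\in X$ (it suffices that the lower limit is at most $\Omega$ for one $x$). Then, for all $\gamma\in\Gamma$ and all $x_0\in X$, $$\bigl|\,d(x_0,\gamma x_0)-\|\gamma\|_{st}\,\bigr| \;<\; 2^{n^2+6n+10}\, n^2\,(n!)^{n+2}\, D\,(\Omega D^n+1)^{n+4}.$$ In particular the difference is bounded by a constant that depends only on $n$, $D$ and $\Omega$. -/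

import Mathlib

open Filter Topology
open scoped ENNReal Nat

/-- A metric space is a length space if the distance between any two points is the infimum of the
lengths (total variations) of the continuous paths joining them. -/
def IsLengthSpace (X : Type*) [MetricSpace X] : Prop :=
  ∀ x y : X, edist x y = ⨅ p : Path x y, eVariationOn p Set.univ

/-- The codiameter of an isometric action of `Γ` on `X`: the diameter of the quotient `Γ \ X`
for the quotient distance, the distance between the classes of `x` and `y` being
the infimum of `d(x, γ y)` over `γ` in `Γ`. -/
noncomputable def codiameter (Γ X : Type*) [Group Γ] [MetricSpace X] [MulAction Γ X] : ℝ≥0∞ :=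
  ⨆ (x : X) (y : X), Metric.infEDist x (MulAction.orbit Γ y)

/-- The asymptotic volume of `Γ`, of rank `n`, for the distance `d(γ₁ x, γ₂ x)`: the limit of
`#{γ : d(x, γ x) < R} / R ^ n` as `R → ∞`. It is written as a lower limit, so that it is
meaningful without a proof of convergence; see `asymptoticVolume_eq_of_tendsto`. -/
noncomputable def asymptoticVolume (Γ : Type*) {X : Type*} [Group Γ] [MetricSpace X]
    [MulAction Γ X] (n : ℕ) (x : X) : ℝ≥0∞ :=
  liminf (fun R : ℝ =>
    (({γ : Γ | dist x (γ • x) < R}.encard : ℕ∞) : ℝ≥0∞) / ENNReal.ofReal R ^ n) atTop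

theorem asymptoticVolume_eq_of_tendsto {Γ X : Type*} [Group Γ] [MetricSpace X] [MulAction Γ X]
    {n : ℕ} {x : X} {ω : ℝ≥0∞}
    (h : Tendsto (fun R : ℝ =>
      (({γ : Γ | dist x (γ • x) < R}.encard : ℕ∞) : ℝ≥0∞) / ENNReal.ofReal R ^ n)
      atTop (𝓝 ω)) :
    asymptoticVolume Γ n x = ω :=
  h.liminf_eq

/-- The stable norm `lim (1 / k) d(x, γ ^ k x)` of `γ`, computed at the base point `x`. -/
noncomputable def stableNorm {Γ X : Type*} [Group Γ] [MetricSpace X] [MulAction Γ X]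
    (x : X) (γ : Γ) : ℝ :=
  limUnder atTop (fun k : ℕ => dist x (γ ^ k • x) / k)

/-- For an isometric action the limit that defines the stable norm exists. -/
theorem tendsto_stableNorm {Γ X : Type*} [Group Γ] [MetricSpace X] [MulAction Γ X]
    [IsIsometricSMul Γ X] (x : X) (γ : Γ) :
    Tendsto (fun k : ℕ => dist x (γ ^ k • x) / k) atTop (𝓝 (stableNorm x γ)) := by
  have h : Subadditive (fun k : ℕ => dist x (γ ^ k • x)) := by
    intro a b
    calc dist x (γ ^ (a + b) • x)
        ≤ dist x (γ ^ a • x) + dist (γ ^ a • x) (γ ^ (a + b) • x) := dist_triangle _ _ _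
      _ = dist x (γ ^ a • x) + dist x (γ ^ b • x) := by rw [pow_add, mul_smul, dist_smul]
  have hb : BddBelow (Set.range fun k : ℕ => dist x (γ ^ k • x) / k) :=
    ⟨0, by rintro _ ⟨k, rfl⟩; positivity⟩
  exact tendsto_nhds_limUnder ⟨_, h.tendsto_lim hb⟩

/-- The stable norm does not depend on the base point. -/
theorem stableNorm_eq {Γ X : Type*} [Group Γ] [MetricSpace X] [MulAction Γ X]
    [IsIsometricSMul Γ X] (x y : X) (γ : Γ) : stableNorm x γ = stableNorm y γ := by
  have key : ∀ x y : X, stableNorm x γ ≤ stableNorm y γ := by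
    intro x y
    have h : Tendsto (fun k : ℕ => dist y (γ ^ k • y) / k + (2 * dist x y) / k) atTop
        (𝓝 (stableNorm y γ + 0)) :=
      (tendsto_stableNorm y γ).add (tendsto_const_div_atTop_nhds_zero_nat _)
    rw [add_zero] at h
    refine le_of_tendsto_of_tendsto' (tendsto_stableNorm x γ) h fun k => ?_
    rw [← add_div]
    gcongr
    have h1 := dist_triangle4 x y (γ ^ k • y) (γ ^ k • x)
    rw [dist_smul, dist_comm y x] at h1
    linarith
  exact le_antisymm (key x y) (key y x)

/-! Write d(g) for the displacement of x₀ by g, a seminorm on ℤⁿ. The heart is an inequality 2 d(γ)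
≤ d(2γ) + C. It makes (d(2^k γ) - C) / 2^k nondecreasing in k, so d(γ) - C is at most the stable
norm, which in turn is at most d(γ).

To halve 2γ, follow an almost shortest path from x₀ to 2γ x₀ and replace its points by nearby orbit
points. The result is a chain in ℤⁿ whose steps lie in the ball S of radius 3D. Regard the steps as
beads coloured by their values. Necklace splitting (`exists_balanced_splitting`) divides them, with
at most t = #S cuts, into two shares that nearly agree in every colour. The sums P and M of the
shares satisfy P + M = 2γ and d(P) + d(M) ≤ d(2γ) + O(tD), while 2(P - γ) = P - M is a combination
of elements of S whose coefficients have total size at most 2t. So P and M are both close to γ,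
which gives the inequality.

The constants are controlled by Ω. A matrix with columns in S and maximal |det| gives every element
of S coordinates at most 1. A packing argument bounds the index of its column lattice, hence also
#S, and short coset representatives turn small coordinates into a small seminorm.

The splitting follows from the octahedral Tucker lemma, which is proved by counting alternating
flags modulo 2 as in Ky Fan's lemma. -/

/-! ### Alternating labellings of a simplex, modulo 2 -/

/-- The labels `w i`, `i ∈ I`, have distinct absolute values, and their signs alternate when they
are ordered by absolute value, the first sign being `s`. -/
def AlternatesOn {ι : Type*} (w : ι → ℤ) (s : ℤ) (I : Finset ι) : Prop :=
  Set.InjOn (fun i => |w i|) I ∧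
    ∀ i ∈ I, (w i).sign = s * (-1) ^ (I.filter fun j => |w j| < |w i|).card

open Classical in
/-- The indicator of a proposition, with values in `ZMod 2`. -/
noncomputable def indicatorTwo (P : Prop) : ZMod 2 := if P then 1 else 0

theorem indicatorTwo_of_true {P : Prop} (h : P) : indicatorTwo P = 1 := if_pos h

theorem indicatorTwo_of_false {P : Prop} (h : ¬ P) : indicatorTwo P = 0 := if_neg h

namespace AlternatesOn

variable {ι : Type*} {w w' : ι → ℤ} {s : ℤ} {I : Finset ι}

theorem congr (h : ∀ i ∈ I, w i = w' i) : AlternatesOn w s I ↔ AlternatesOn w' s I := by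
  have key : ∀ {w w' : ι → ℤ}, (∀ i ∈ I, w i = w' i) → AlternatesOn w s I →
      AlternatesOn w' s I := by
    intro w w' h hw
    refine ⟨fun i hi j hj hij => hw.1 hi hj ?_, fun i hi => ?_⟩
    · simpa [h i hi, h j hj] using hij
    · rw [← h i hi, hw.2 i hi]
      congr 3
      refine Finset.filter_congr fun j hj => ?_
      rw [h j hj]
  exact ⟨key h, key fun i hi => (h i hi).symm⟩

theorem neg_iff (h : ∀ i ∈ I, w' i = -w i) : AlternatesOn w' s I ↔ AlternatesOn w (-s) I := by
  rw [congr h]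
  unfold AlternatesOn
  simp only [abs_neg, Int.sign_neg, neg_mul, neg_eq_iff_eq_neg]

theorem empty : AlternatesOn w s ∅ := by simp [AlternatesOn]

/-- A vertex with the largest label comes last in the order, so it affects no earlier sign. This is
the inductive step for `sum_erase`. -/
theorem insert_iff [DecidableEq ι] {a : ι} (h : ∀ x ∈ I, |w x| < |w a|) :
    AlternatesOn w s (insert a I) ↔
      AlternatesOn w s I ∧ (w a).sign = s * (-1) ^ I.card := by
  have ha : a ∉ I := fun h' => lt_irrefl _ (h a h')
  have h1 : ((insert a I).filter fun j => |w j| < |w a|) = I := by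
    ext j
    simp only [Finset.mem_filter, Finset.mem_insert]
    constructor
    · rintro ⟨rfl | hj, hlt⟩
      · exact absurd hlt (lt_irrefl _)
      · exact hj
    · intro hj
      exact ⟨Or.inr hj, h j hj⟩
  have h2 : ∀ i ∈ I, ((insert a I).filter fun j => |w j| < |w i|) =
      I.filter fun j => |w j| < |w i| := by
    intro i hi
    rw [Finset.filter_insert, if_neg (not_lt.2 (h i hi).le)]
  unfold AlternatesOn
  constructor
  · rintro ⟨hinj, hs⟩
    refine ⟨⟨hinj.mono (by simp), fun i hi => ?_⟩, ?_⟩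
    · rw [hs i (Finset.mem_insert_of_mem hi), h2 i hi]
    · rw [hs a (Finset.mem_insert_self _ _), h1]
  · rintro ⟨⟨hinj, hs⟩, hsa⟩
    refine ⟨?_, fun i hi => ?_⟩
    · rw [Finset.coe_insert, Set.injOn_insert (by simpa using ha)]
      refine ⟨hinj, ?_⟩
      rintro ⟨x, hx, hxa⟩
      exact (h x hx).ne hxa
    · rcases Finset.mem_insert.1 hi with rfl | hi
      · rw [hsa, h1]
      · rw [hs i hi, h2 i hi]

/-- The transposition of `a` and `b` preserves labels and carries one facet to the other. -/
theorem of_replace [DecidableEq ι] {a b : ι} (hab : w b = w a) (ha : a ∈ I) (hb : b ∈ I)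
    (h : AlternatesOn w s (I.erase a)) : AlternatesOn w s (I.erase b) := by
  rcases eq_or_ne a b with rfl | hne
  · exact h
  set f : Equiv.Perm ι := Equiv.swap a b with hf
  have hwf : ∀ i, w (f i) = w i := by
    intro i
    rcases eq_or_ne i a with rfl | hia
    · rw [hf, Equiv.swap_apply_left, hab]
    rcases eq_or_ne i b with rfl | hib
    · rw [hf, Equiv.swap_apply_right, hab]
    · rw [hf, Equiv.swap_apply_of_ne_of_ne hia hib]
  have hmem : ∀ i ∈ I.erase b, f i ∈ I.erase a := by
    intro i hi
    rw [Finset.mem_erase] at hi ⊢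
    rcases eq_or_ne i a with rfl | hia
    · rw [hf, Equiv.swap_apply_left]; exact ⟨hne.symm, hb⟩
    · rw [hf, Equiv.swap_apply_of_ne_of_ne hia hi.1]; exact ⟨hia, hi.2⟩
  have hmem' : ∀ i ∈ I.erase a, f i ∈ I.erase b := by
    intro i hi
    rw [Finset.mem_erase] at hi ⊢
    rcases eq_or_ne i b with rfl | hib
    · rw [hf, Equiv.swap_apply_right]; exact ⟨hne, ha⟩
    · rw [hf, Equiv.swap_apply_of_ne_of_ne hi.1 hib]; exact ⟨hib, hi.2⟩
  have hff : ∀ i, f (f i) = i := fun i => Equiv.swap_apply_self a b i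
  refine ⟨fun i hi j hj hij => ?_, fun i hi => ?_⟩
  · have := h.1 (hmem i hi) (hmem j hj) (by simpa only [hwf] using hij)
    exact f.injective this
  · rw [← hwf i, h.2 _ (hmem i hi)]
    congr 2
    refine Finset.card_bij' (fun i _ => f i) (fun i _ => f i) ?_ ?_ ?_ ?_
    · intro j hj
      rw [Finset.mem_filter] at hj ⊢
      exact ⟨hmem' j hj.1, by simpa only [hwf] using hj.2⟩
    · intro j hj
      rw [Finset.mem_filter] at hj ⊢
      exact ⟨hmem j hj.1, by simpa only [hwf] using hj.2⟩
    · intro j _; exact hff j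
    · intro j _; exact hff j

/-- The number of facets of a simplex that alternate with first sign `1` is odd if and only if the
simplex alternates, provided that no two labels are opposite. -/
theorem sum_erase [DecidableEq ι] (w : ι → ℤ) (I : Finset ι) (hI : I.Nonempty)
    (h0 : ∀ i ∈ I, w i ≠ 0) (hc : ∀ i ∈ I, ∀ j ∈ I, w i ≠ -w j) :
    ∑ i ∈ I, indicatorTwo (AlternatesOn w 1 (I.erase i)) =
      indicatorTwo (AlternatesOn w 1 I) + indicatorTwo (AlternatesOn w (-1) I) := by
  induction I using Finset.induction_on_max_value (fun i => |w i|) with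
  | empty => exact absurd hI (by simp)
  | insert a s has hmax ih =>
    have hsign : (w a).sign = 1 ∨ (w a).sign = -1 := by
      rcases lt_trichotomy (w a) 0 with h | h | h
      · exact Or.inr (Int.sign_eq_neg_one_of_neg h)
      · exact absurd h (h0 a (Finset.mem_insert_self _ _))
      · exact Or.inl (Int.sign_eq_one_of_pos h)
    -- If the largest label occurs at both `a` and `b`, only the facets that omit one of them can
    -- alternate, and these two cancel modulo 2.
    by_cases htie : ∃ b ∈ s, |w b| = |w a|
    · obtain ⟨b, hb, hba⟩ := htie
      have hwb : w b = w a := by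
        rcases abs_eq_abs.1 hba with h | h
        · exact h
        · exact absurd h (hc b (Finset.mem_insert_of_mem hb) a (Finset.mem_insert_self _ _))
      have hne : a ≠ b := fun h => has (h ▸ hb)
      have hno : ∀ {J : Finset ι} {t : ℤ}, a ∈ J → b ∈ J → ¬ AlternatesOn w t J :=
        fun ha hb h => hne (h.1 ha hb hba.symm)
      rw [indicatorTwo_of_false (hno (Finset.mem_insert_self _ _) (Finset.mem_insert_of_mem hb)),
        indicatorTwo_of_false (hno (Finset.mem_insert_self _ _) (Finset.mem_insert_of_mem hb)),
        Finset.sum_insert has, ← Finset.add_sum_erase _ _ hb, Finset.sum_eq_zero]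
      · have heq : AlternatesOn w 1 ((insert a s).erase a) ↔
            AlternatesOn w 1 ((insert a s).erase b) :=
          ⟨of_replace hwb (Finset.mem_insert_self _ _) (Finset.mem_insert_of_mem hb),
            of_replace hwb.symm (Finset.mem_insert_of_mem hb) (Finset.mem_insert_self _ _)⟩
        rw [heq, add_zero, add_zero]
        exact CharTwo.add_self_eq_zero _
      · intro i hi
        rw [Finset.mem_erase] at hi
        refine indicatorTwo_of_false (hno ?_ ?_)
        · rw [Finset.mem_erase]
          exact ⟨fun h => has (h ▸ hi.2), Finset.mem_insert_self _ _⟩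
        · rw [Finset.mem_erase]
          exact ⟨hi.1.symm, Finset.mem_insert_of_mem hb⟩
    · have hlt : ∀ x ∈ s, |w x| < |w a| := fun x hx =>
        lt_of_le_of_ne (hmax x hx) fun h => htie ⟨x, hx, h⟩
      rw [Finset.sum_insert has, Finset.erase_insert has, insert_iff hlt, insert_iff hlt]
      -- Omitting a vertex other than `a` moves `a` down one place, so the sign required of it is
      -- reversed.
      have hterm : ∀ i ∈ s, indicatorTwo (AlternatesOn w 1 ((insert a s).erase i)) =
          indicatorTwo (AlternatesOn w 1 (s.erase i) ∧
            (w a).sign = -(-1) ^ s.card) := by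
        intro i hi
        have hai : a ≠ i := fun h => has (h ▸ hi)
        rw [Finset.erase_insert_of_ne hai,
          insert_iff fun x hx => hlt x (Finset.mem_of_mem_erase hx), Finset.card_erase_of_mem hi]
        congr 3
        obtain ⟨m, hm⟩ : ∃ m, s.card = m + 1 :=
          ⟨s.card - 1, by have := Finset.card_pos.2 ⟨i, hi⟩; omega⟩
        rw [hm, pow_succ]; simp
      rw [Finset.sum_congr rfl hterm]
      rcases s.eq_empty_or_nonempty with rfl | hs
      · rcases hsign with h | h <;> simp [h, indicatorTwo, empty]
      have ih' := ih hs (fun i hi => h0 i (Finset.mem_insert_of_mem hi))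
        fun i hi j hj => hc i (Finset.mem_insert_of_mem hi) j (Finset.mem_insert_of_mem hj)
      have hcase : (w a).sign = (-1) ^ s.card ∨ (w a).sign = -(-1) ^ s.card := by
        rcases neg_one_pow_eq_or ℤ s.card with h | h <;> rw [h] <;> rcases hsign with h' | h' <;>
          simp [h']
      have hpow : ((-1 : ℤ) ^ s.card) ≠ -(-1) ^ s.card := by
        rcases neg_one_pow_eq_or ℤ s.card with h | h <;> rw [h] <;> decide
      rcases hcase with h | h
      · simp only [h, hpow, and_false, one_mul, and_true, neg_mul]
        simp [indicatorTwo]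
      · simp only [h, hpow.symm, and_false, one_mul, and_true, neg_mul]
        rw [ih', indicatorTwo_of_false (P := False) id, zero_add, ← add_assoc,
          CharTwo.add_self_eq_zero, zero_add]

end AlternatesOn

/-! ### Flags of sign vectors and Ky Fan's lemma -/

/-- A maximal flag of sign vectors of length `N`: the order in which the coordinates become
nonzero, and their signs. -/
abbrev SignFlag (N : ℕ) := Equiv.Perm (Fin N) × (Fin N → ℤˣ)

namespace SignFlag

variable {N : ℕ}

/-- The member of a flag with `i + 1` nonzero coordinates. -/
def vec (F : SignFlag N) (i : ℕ) : Fin N → ℤ :=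
  fun j => if (F.1.symm j : ℕ) ≤ i then (F.2 j : ℤ) else 0

open Classical in
/-- The flags that fill a `k`-dimensional hemisphere: only the coordinates up to `k` are used, and
the coordinate `k` is not negative. -/
noncomputable def hemisphere (N k : ℕ) : Finset (SignFlag N) :=
  Finset.univ.filter fun F => (∀ j : Fin N, k < j → F.1 j = j) ∧ ∀ j : Fin N, k ≤ j → F.2 j = 1

open Classical in
/-- The flags that fill a `k`-dimensional sphere. -/
noncomputable def sphere (N k : ℕ) : Finset (SignFlag N) :=
  Finset.univ.filter fun F => (∀ j : Fin N, k < j → F.1 j = j) ∧ ∀ j : Fin N, k < j → F.2 j = 1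

theorem mem_hemisphere {k : ℕ} {F : SignFlag N} : F ∈ hemisphere N k ↔
    (∀ j : Fin N, k < j → F.1 j = j) ∧ ∀ j : Fin N, k ≤ j → F.2 j = 1 := by
  simp [hemisphere]

theorem mem_sphere {k : ℕ} {F : SignFlag N} : F ∈ sphere N k ↔
    (∀ j : Fin N, k < j → F.1 j = j) ∧ ∀ j : Fin N, k < j → F.2 j = 1 := by
  simp [sphere]

theorem hemisphere_zero [NeZero N] : hemisphere N 0 = {(1, 1)} := by
  ext ⟨σ, ε⟩
  rw [mem_hemisphere, Finset.mem_singleton, Prod.mk.injEq]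
  constructor
  · rintro ⟨h1, h2⟩
    have h0 : ∀ j : Fin N, j ≠ 0 → σ j = j := fun j hj =>
      h1 j (Nat.pos_of_ne_zero fun h => hj (Fin.ext (by simpa using h)))
    refine ⟨Equiv.ext fun j => ?_, funext fun j => h2 j (Nat.zero_le _)⟩
    rcases eq_or_ne j 0 with rfl | hj
    · by_contra hne
      exact hne (σ.injective (h0 _ hne))
    · exact h0 j hj
  · rintro ⟨rfl, rfl⟩
    simp

/-- Exchange the coordinates that become nonzero in the places `a` and `b`. -/
def exchange (a b : Fin N) (F : SignFlag N) : SignFlag N := (F.1 * Equiv.swap a b, F.2)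

theorem exchange_exchange (a b : Fin N) (F : SignFlag N) :
    exchange a b (exchange a b F) = F := by
  simp [exchange, mul_assoc]

theorem exchange_ne {a b : Fin N} (hab : a ≠ b) (F : SignFlag N) : exchange a b F ≠ F := by
  intro h
  have h1 := congrArg (fun F : SignFlag N => F.1 a) h
  simp only [exchange, Equiv.Perm.mul_apply, Equiv.swap_apply_left] at h1
  exact hab (F.1.injective h1).symm

/-- Two flags related by an adjacent exchange share the facet that omits the member `a`; this pairs
off the facets omitting a member other than the last. -/
theorem vec_exchange {a b : Fin N} (hab : (b : ℕ) = a + 1) (F : SignFlag N) {m : ℕ}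
    (hm : m ≠ a) : (exchange a b F).vec m = F.vec m := by
  funext j
  have h : (exchange a b F).1.symm j = Equiv.swap a b (F.1.symm j) := by
    rw [Equiv.symm_apply_eq]
    simp [exchange]
  unfold vec
  rw [h]
  have h2 : ((Equiv.swap a b (F.1.symm j) : Fin N) : ℕ) ≤ m ↔ (F.1.symm j : ℕ) ≤ m := by
    rcases eq_or_ne (F.1.symm j) a with h | h
    · rw [h, Equiv.swap_apply_left]; omega
    rcases eq_or_ne (F.1.symm j) b with h' | h'
    · rw [h', Equiv.swap_apply_right]; omega
    · rw [Equiv.swap_apply_of_ne_of_ne h h']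
  simp only [h2]
  rfl

theorem exchange_mem {a b : Fin N} {k : ℕ} (ha : (a : ℕ) ≤ k) (hb : (b : ℕ) ≤ k)
    {F : SignFlag N} (hF : F ∈ hemisphere N k) : exchange a b F ∈ hemisphere N k := by
  rw [mem_hemisphere] at hF ⊢
  refine ⟨fun j hj => ?_, hF.2⟩
  have h1 : j ≠ a := fun h => by rw [h] at hj; omega
  have h2 : j ≠ b := fun h => by rw [h] at hj; omega
  simp only [exchange, Equiv.Perm.mul_apply, Equiv.swap_apply_of_ne_of_ne h1 h2]
  exact hF.1 j hj

/-- Change the sign of the coordinate that becomes nonzero in the place `a`. -/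
def flip (a : Fin N) (F : SignFlag N) : SignFlag N :=
  (F.1, Function.update F.2 (F.1 a) (-F.2 (F.1 a)))

theorem flip_flip (a : Fin N) (F : SignFlag N) : flip a (flip a F) = F := by
  simp [flip]

theorem flip_ne (a : Fin N) (F : SignFlag N) : flip a F ≠ F := by
  intro h
  have h1 := congrArg (fun G : SignFlag N => G.2 (F.1 a)) h
  simp only [flip, Function.update_self] at h1
  rcases Int.units_eq_one_or (F.2 (F.1 a)) with h2 | h2 <;> rw [h2] at h1 <;>
    exact absurd h1 (by decide)

theorem vec_flip {a : Fin N} (F : SignFlag N) {m : ℕ} (hm : m < a) :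
    (flip a F).vec m = F.vec m := by
  funext j
  unfold vec flip
  dsimp only
  split_ifs with h
  · rw [Function.update_of_ne]
    rintro rfl
    simp at h
    omega
  · rfl

/-- Only the sign of the coordinate `a` is prescribed among those in use, so the flip stays in the
hemisphere when another coordinate enters last. -/
theorem flip_mem {a : Fin N} {F : SignFlag N} (hF : F ∈ hemisphere N a) (ha : F.1 a ≠ a) :
    flip a F ∈ hemisphere N a := by
  rw [mem_hemisphere] at hF ⊢
  refine ⟨hF.1, fun j hj => ?_⟩
  have hne : j ≠ F.1 a := by
    intro h
    rcases hj.lt_or_eq with h' | h'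
    · have := hF.1 j h'
      rw [h] at this
      have h3 := F.1.injective this
      rw [← h3, ← h3] at this
      exact ha (by rw [h3])
    · exact ha (h ▸ Fin.ext h'.symm)
  simp only [flip, Function.update_of_ne hne]
  exact hF.2 j hj

open Classical in
-- The flags whose top facet has no second neighbour in the hemisphere are those lying over its
-- boundary sphere.
theorem filter_hemisphere {k : ℕ} {a : Fin N} (ha : (a : ℕ) = k + 1) :
    (hemisphere N (k + 1)).filter (fun F => F.1 a = a) = sphere N k := by
  ext F
  rw [Finset.mem_filter, mem_hemisphere, mem_sphere]
  constructor
  · rintro ⟨⟨h1, h2⟩, h3⟩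
    refine ⟨fun j hj => ?_, fun j hj => h2 j hj⟩
    rcases eq_or_ne j a with rfl | hne
    · exact h3
    · exact h1 j (by have := fun h => hne (Fin.ext h); omega)
  · rintro ⟨h1, h2⟩
    exact ⟨⟨fun j hj => h1 j (by omega), fun j hj => h2 j hj⟩, h1 a (by omega)⟩

/-- The antipodal flag within the first `k + 1` coordinates. -/
def antipode (k : ℕ) (F : SignFlag N) : SignFlag N :=
  (F.1, fun j => if (j : ℕ) ≤ k then -F.2 j else F.2 j)

theorem antipode_antipode (k : ℕ) (F : SignFlag N) : antipode k (antipode k F) = F := by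
  refine Prod.ext rfl (funext fun j => ?_)
  simp only [antipode]
  split_ifs <;> simp

theorem antipode_mem {k : ℕ} {F : SignFlag N} (hF : F ∈ sphere N k) :
    antipode k F ∈ sphere N k := by
  rw [mem_sphere] at hF ⊢
  refine ⟨hF.1, fun j hj => ?_⟩
  simp only [antipode, if_neg (not_le.2 hj)]
  exact hF.2 j hj

theorem vec_antipode {k : ℕ} {F : SignFlag N} (hF : F ∈ sphere N k) {i : ℕ} (hi : i ≤ k) :
    (antipode k F).vec i = -F.vec i := by
  funext j
  have hsymm : (antipode k F).1.symm j = F.1.symm j := rfl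
  simp only [vec, hsymm, Pi.neg_apply]
  by_cases h1 : (F.1.symm j : ℕ) ≤ i
  · have h2 : (j : ℕ) ≤ k := by
      by_contra h2
      have h3 : F.1.symm j = j := by
        rw [Equiv.symm_apply_eq, (mem_sphere.1 hF).1 j (by omega)]
      rw [h3] at h1
      omega
    simp [antipode, h1, h2]
  · simp [h1]

theorem sum_sphere {k : ℕ} (hk : k < N) (f : SignFlag N → ZMod 2) :
    ∑ F ∈ sphere N k, f F = ∑ F ∈ hemisphere N k, (f F + f (antipode k F)) := by
  classical
  have h1 : (sphere N k).filter (fun F => F.2 ⟨k, hk⟩ = 1) = hemisphere N k := by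
    ext F
    rw [Finset.mem_filter, mem_hemisphere, mem_sphere]
    constructor
    · rintro ⟨⟨h1, h2⟩, h3⟩
      refine ⟨h1, fun j hj => ?_⟩
      rcases hj.lt_or_eq with h | h
      · exact h2 j h
      · obtain rfl : j = ⟨k, hk⟩ := Fin.ext h.symm
        exact h3
    · rintro ⟨h1, h2⟩
      exact ⟨⟨h1, fun j hj => h2 j hj.le⟩, h2 _ le_rfl⟩
  rw [← Finset.sum_filter_add_sum_filter_not _ (fun F => F.2 ⟨k, hk⟩ = 1), Finset.sum_add_distrib,
    h1]
  congr 1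
  rw [← h1]
  refine Finset.sum_bij' (fun F _ => antipode k F) (fun F _ => antipode k F) ?_ ?_ ?_ ?_ ?_
  · intro F hF
    rw [Finset.mem_filter] at hF ⊢
    refine ⟨antipode_mem hF.1, ?_⟩
    rcases Int.units_eq_one_or (F.2 ⟨k, hk⟩) with h | h
    · exact absurd h hF.2
    · simp [antipode, h]
  · intro F hF
    rw [Finset.mem_filter] at hF ⊢
    refine ⟨antipode_mem hF.1, ?_⟩
    simp only [antipode, hF.2, le_refl, if_true]
    decide
  · intro F _; exact antipode_antipode k F
  · intro F _; exact antipode_antipode k F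
  · intro F _; rw [antipode_antipode]

/-- Ky Fan's lemma for the barycentric subdivision of the boundary of a cross-polytope: the number
of alternating flags in a hemisphere is odd. -/
theorem sum_alternatesOn (l : (Fin N → ℤ) → ℤ) (hodd : ∀ A, l (-A) = -l A)
    (h0 : ∀ (F : SignFlag N) (i : ℕ), l (F.vec i) ≠ 0)
    (hc : ∀ (F : SignFlag N) (i j : ℕ), l (F.vec i) ≠ -l (F.vec j)) (k : ℕ) (hk : k < N) :
    ∑ F ∈ hemisphere N k,
      (indicatorTwo (AlternatesOn (fun i => l (F.vec i)) 1 (Finset.range (k + 1))) +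
        indicatorTwo (AlternatesOn (fun i => l (F.vec i)) (-1) (Finset.range (k + 1)))) = 1 := by
  classical
  have hfacet : ∀ (k : ℕ) (F : SignFlag N), _ := fun k F =>
    AlternatesOn.sum_erase (fun i => l (F.vec i)) (Finset.range (k + 1)) (by simp)
      (fun i _ => h0 F i) (fun i _ j _ => hc F i j)
  induction k with
  | zero =>
    have : NeZero N := ⟨hk.ne'⟩
    simp_rw [← hfacet]
    rw [hemisphere_zero]
    rw [Finset.sum_singleton, zero_add, Finset.range_one, Finset.sum_singleton]
    exact indicatorTwo_of_true (by simpa using AlternatesOn.empty)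
  | succ k ih =>
    -- Modulo 2, alternating flags are counted by pairs of a flag and a facet alternating with first
    -- sign `1`.
    simp_rw [← hfacet]
    rw [Finset.sum_comm, Finset.sum_range_succ, Finset.sum_eq_zero, zero_add]
    · have herase : (Finset.range (k + 1 + 1)).erase (k + 1) = Finset.range (k + 1) := by
        rw [Finset.range_add_one, Finset.erase_insert (by simp)]
      rw [herase, ← Finset.sum_filter_add_sum_filter_not _ (fun F => F.1 ⟨k + 1, hk⟩ = ⟨k + 1, hk⟩),
        filter_hemisphere rfl]
      have hz : ∑ F ∈ (hemisphere N (k + 1)).filter (fun F => ¬ F.1 ⟨k + 1, hk⟩ = ⟨k + 1, hk⟩),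
          indicatorTwo (AlternatesOn (fun i => l (F.vec i)) 1 (Finset.range (k + 1))) = 0 := by
        -- Facets that omit the top member and do not lie on the boundary belong to exactly two
        -- flags, related by a flip.
        refine Finset.sum_involution (fun F _ => flip ⟨k + 1, hk⟩ F) ?_ ?_ ?_ ?_
        · intro F _
          rw [AlternatesOn.congr (w := fun i => l ((flip ⟨k + 1, hk⟩ F).vec i))
            (w' := fun i => l (F.vec i))]
          · exact CharTwo.add_self_eq_zero _
          · intro i hi
            rw [vec_flip F (by simpa using hi)]
        · intro F _ _
          exact flip_ne _ F
        · intro F hF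
          rw [Finset.mem_filter] at hF ⊢
          exact ⟨flip_mem (a := ⟨k + 1, hk⟩) hF.1 hF.2, hF.2⟩
        · intro F _
          exact flip_flip _ F
      -- What remains is the boundary sphere, that is, a hemisphere and its antipode. As `l` is odd,
      -- the antipode contributes the facets with first sign `-1`, which is the induction
      -- hypothesis.
      rw [hz, add_zero, sum_sphere (by omega), ← ih (by omega)]
      refine Finset.sum_congr rfl fun F hF => ?_
      congr 2
      rw [AlternatesOn.neg_iff (w := fun i => l (F.vec i))]
      intro i hi
      rw [vec_antipode _ (by simpa [Nat.lt_succ_iff] using hi), hodd]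
      have hF' := mem_hemisphere.1 hF
      exact mem_sphere.2 ⟨hF'.1, fun j hj => hF'.2 j hj.le⟩
    · intro i hi
      rw [Finset.mem_range] at hi
      refine Finset.sum_involution
        (fun F _ => exchange ⟨i, by omega⟩ ⟨i + 1, by omega⟩ F) ?_ ?_ ?_ ?_
      · intro F _
        rw [AlternatesOn.congr
          (w := fun m => l ((exchange ⟨i, by omega⟩ ⟨i + 1, by omega⟩ F).vec m))
          (w' := fun m => l (F.vec m))]
        · exact CharTwo.add_self_eq_zero _
        · intro m hm
          rw [vec_exchange rfl F (by simpa using Finset.ne_of_mem_erase hm)]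
      · intro F _ _
        exact exchange_ne (by simp [Fin.ext_iff]) F
      · intro F hF
        exact exchange_mem (by simp; omega) (by simp; omega) hF
      · intro F _
        exact exchange_exchange _ _ F

end SignFlag

/-! ### The octahedral Tucker lemma -/

/-- A vector all of whose entries are `0`, `1` or `-1`. -/
def IsSignVector {N : ℕ} (A : Fin N → ℤ) : Prop := ∀ j, A j = 0 ∨ A j = 1 ∨ A j = -1

/-- The octahedral Tucker lemma. -/
theorem exists_complementary_pair {N : ℕ} (hN : 0 < N) (l : (Fin N → ℤ) → ℤ)
    (hodd : ∀ A, l (-A) = -l A)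
    (hl : ∀ A, IsSignVector A → A ≠ 0 → l A ≠ 0 ∧ |l A| < N) :
    ∃ A B, IsSignVector A ∧ IsSignVector B ∧ A ≠ 0 ∧ (∀ j, A j ≠ 0 → B j = A j) ∧
      l A = -l B := by
  by_contra hcon
  push Not at hcon
  have hsign : ∀ (F : SignFlag N) i, IsSignVector (F.vec i) := by
    intro F i j
    unfold SignFlag.vec
    split_ifs
    · rcases Int.units_eq_one_or (F.2 j) with h | h <;> simp [h]
    · exact Or.inl rfl
  have hne : ∀ (F : SignFlag N) i, F.vec i ≠ 0 := by
    intro F i h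
    have h1 := congrFun h (F.1 ⟨0, hN⟩)
    simp [SignFlag.vec] at h1
  have hmono : ∀ (F : SignFlag N) (i j : ℕ), i ≤ j → ∀ m, F.vec i m ≠ 0 → F.vec j m = F.vec i m := by
    intro F i j hij m hm
    have h1 : (F.1.symm m : ℕ) ≤ i := by
      by_contra h
      exact hm (if_neg h)
    simp [SignFlag.vec, h1, h1.trans hij]
  have hc : ∀ (F : SignFlag N) (i j : ℕ), l (F.vec i) ≠ -l (F.vec j) := by
    intro F i j
    rcases le_total i j with h | h
    · exact hcon _ _ (hsign F i) (hsign F j) (hne F i) (hmono F i j h)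
    · intro h'
      exact hcon _ _ (hsign F j) (hsign F i) (hne F j) (hmono F j i h) (by rw [h', neg_neg])
  have hsum := SignFlag.sum_alternatesOn l hodd (fun F i => (hl _ (hsign F i) (hne F i)).1) hc
    (N - 1) (by omega)
  obtain ⟨F, s, hF⟩ : ∃ (F : SignFlag N) (s : ℤ),
      AlternatesOn (fun i => l (F.vec i)) s (Finset.range (N - 1 + 1)) := by
    by_contra hno
    push Not at hno
    rw [Finset.sum_eq_zero] at hsum
    · exact zero_ne_one hsum
    · intro F _
      rw [indicatorTwo_of_false (hno F 1), indicatorTwo_of_false (hno F (-1)), add_zero]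
  -- An alternating flag has `N` labels with distinct absolute values, but only `1, ..., N - 1` are
  -- available.
  have hcard := Finset.card_le_card_of_injOn (s := Finset.range (N - 1 + 1))
    (t := Finset.Ioo (0 : ℤ) N) (fun i => |l (F.vec i)|) (by
      intro i _
      have := hl _ (hsign F i) (hne F i)
      simpa using this) hF.1
  simp at hcard

/-! ### Sign blocks and necklace splitting -/

/-- The number of sign blocks among the first `k` terms of a sequence, zeros being ignored,
together with the last nonzero term. -/
def signBlocks (z : ℕ → ℤ) : ℕ → ℕ × ℤ
  | 0 => (0, 0)
  | k + 1 =>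
    if z k = 0 ∨ z k = (signBlocks z k).2 then signBlocks z k else ((signBlocks z k).1 + 1, z k)

/-- If `A` starts a block where `B` does not, both now end with the same sign, so a deficit of one
block becomes equality of the whole states. Keeping the last sign in the state is what makes the
induction work. -/
theorem signBlocks_lt_or_eq {A B : ℕ → ℤ} (h : ∀ j, A j ≠ 0 → B j = A j) (k : ℕ) :
    (signBlocks A k).1 < (signBlocks B k).1 ∨ signBlocks A k = signBlocks B k := by
  induction k with
  | zero => exact Or.inr rfl
  | succ k ih =>
    simp only [signBlocks]
    generalize signBlocks A k = p at ih ⊢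
    generalize signBlocks B k = q at ih ⊢
    obtain ⟨a, a'⟩ := p
    obtain ⟨b, b'⟩ := q
    have hk := h k
    simp only [Prod.mk.injEq] at ih
    by_cases h0 : A k = 0
    · rw [if_pos (Or.inl h0)]
      split_ifs with h1
      · simpa only [Prod.mk.injEq] using ih
      · left
        dsimp only at ih ⊢
        omega
    · have := hk h0
      rw [this]
      split_ifs with h1 h2 h2 <;> simp only [Prod.mk.injEq, and_true] <;> simp only [h0, false_or] at h1 h2 <;>
        omega

theorem signBlocks_neg (z : ℕ → ℤ) (k : ℕ) :
    signBlocks (-z) k = ((signBlocks z k).1, -(signBlocks z k).2) := by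
  induction k with
  | zero => simp [signBlocks]
  | succ k ih =>
    simp only [signBlocks, ih, Pi.neg_apply, neg_eq_zero, neg_inj]
    split_ifs <;> rfl

theorem signBlocks_le (z : ℕ → ℤ) (k : ℕ) :
    (signBlocks z k).1 ≤ ((Finset.range k).filter fun j => z j ≠ 0).card := by
  induction k with
  | zero => simp [signBlocks]
  | succ k ih =>
    rw [signBlocks, Finset.range_add_one, Finset.filter_insert]
    by_cases h : z k = 0
    · simpa [h] using ih
    · rw [if_pos h, Finset.card_insert_of_notMem (by simp)]
      split_ifs
      · exact ih.trans (Nat.le_succ _)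
      · exact Nat.succ_le_succ ih

theorem signBlocks_snd (z : ℕ → ℤ) (hz : ∀ j, z j = 0 ∨ z j = 1 ∨ z j = -1) (k : ℕ) :
    ((∀ j < k, z j = 0) ∧ signBlocks z k = (0, 0)) ∨
      (1 ≤ (signBlocks z k).1 ∧ ((signBlocks z k).2 = 1 ∨ (signBlocks z k).2 = -1)) := by
  induction k with
  | zero => exact Or.inl ⟨by simp, rfl⟩
  | succ k ih =>
    rw [signBlocks]
    split_ifs with h
    · rcases ih with ⟨h1, h2⟩ | h1
      · left
        refine ⟨fun j hj => ?_, h2⟩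
        rcases Nat.lt_succ_iff_lt_or_eq.1 hj with hj | rfl
        · exact h1 j hj
        · simpa [h2] using h
      · exact Or.inr h1
    · right
      push Not at h
      exact ⟨by simp, (hz k).resolve_left h.1⟩

theorem signBlocks_of_ne_zero (z : ℕ → ℤ) (hz : ∀ j, z j ≠ 0) (k : ℕ) :
    signBlocks z (k + 1) =
      (((Finset.range k).filter fun j => z (j + 1) ≠ z j).card + 1, z k) := by
  induction k with
  | zero => simp [signBlocks, hz]
  | succ k ih =>
    rw [signBlocks, ih, Finset.range_add_one, Finset.filter_insert]
    by_cases h : z (k + 1) = z k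
    · simp [h]
    · simp [h, hz]

/-- A sequence of `N` beads of `t` colours can be divided between two persons by at most `t` cuts
so that the shares of the different colours differ by at most `2 t` beads altogether. -/
theorem exists_balanced_splitting {τ : Type*} [Fintype τ] [Nonempty τ] [DecidableEq τ] (N : ℕ)
    (c : ℕ → τ) (hN : Fintype.card τ < N) :
    ∃ y : ℕ → ℤ, (∀ j, y j = 1 ∨ y j = -1) ∧
      ((Finset.range (N - 1)).filter fun j => y (j + 1) ≠ y j).card ≤ Fintype.card τ ∧
      ∑ i, |∑ j ∈ (Finset.range N).filter (fun j => c j = i), y j| ≤ 2 * Fintype.card τ := by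
  classical
  set t := Fintype.card τ with ht
  let ext : (Fin N → ℤ) → ℕ → ℤ := fun z j => if h : j < N then z ⟨j, h⟩ else 0
  have ext_neg : ∀ z, ext (-z) = -ext z := by
    intro z; funext j; simp only [ext, Pi.neg_apply]; split_ifs <;> simp
  have ext_sign : ∀ z, IsSignVector z → ∀ j, ext z j = 0 ∨ ext z j = 1 ∨ ext z j = -1 := by
    intro z hz j
    simp only [ext]
    split_ifs
    · exact hz _
    · exact Or.inl rfl
  -- The twist by `(-1) ^ j` makes many sign blocks of `z` correspond to few cuts of the splitting.
  let share : (Fin N → ℤ) → ℤ → τ → Finset ℕ := fun z s i =>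
    (Finset.range N).filter fun j => c j = i ∧ (-1) ^ j * ext z j = s
  let tot : τ → ℕ := fun i => ((Finset.range N).filter fun j => c j = i).card
  have share_neg : ∀ z s i, share (-z) s i = share z (-s) i := by
    intro z s i
    simp only [share, ext_neg, Pi.neg_apply, mul_neg, neg_eq_iff_eq_neg]
  have share_add : ∀ z i, (share z 1 i).card + (share z (-1) i).card + (share z 0 i).card ≤
      tot i := by
    intro z i
    rw [← Finset.card_union_of_disjoint, ← Finset.card_union_of_disjoint]
    · refine Finset.card_le_card fun j hj => ?_
      simp only [share, Finset.mem_union, Finset.mem_filter] at hj ⊢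
      tauto
    · rw [Finset.disjoint_left]
      intro j hj hj'
      simp only [share, Finset.mem_union, Finset.mem_filter] at hj hj'
      omega
    · rw [Finset.disjoint_left]
      intro j hj hj'
      simp only [share, Finset.mem_filter] at hj hj'
      omega
  let major : (Fin N → ℤ) → τ → Prop := fun z i =>
    tot i < 2 * (share z 1 i).card ∨ tot i < 2 * (share z (-1) i).card
  have major_neg : ∀ z, major (-z) = major z := by
    intro z; funext i
    simp only [major, share_neg, neg_neg]
    exact propext or_comm
  -- The aim is a vector with many blocks for which neither person has more than half of any colour.
  -- Otherwise the labelling `l` below contradicts Tucker's lemma.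
  obtain ⟨z, hz, hz0, hzN, hzm⟩ : ∃ z, IsSignVector z ∧ z ≠ 0 ∧
      N ≤ (signBlocks (ext z) N).1 + t ∧ ∀ i, ¬ major z i := by
    by_contra hcon
    push Not at hcon
    let i₀ : (Fin N → ℤ) → τ := fun z => Classical.epsilon (major z)
    let sg : (Fin N → ℤ) → ℤ := fun z =>
      (if tot (i₀ z) < 2 * (share z 1 (i₀ z)).card then 1 else 0) -
        if tot (i₀ z) < 2 * (share z (-1) (i₀ z)).card then 1 else 0
    let idx : τ → ℕ := fun i => (Fintype.equivFin τ i : ℕ)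
    have idx_lt : ∀ i, idx i < t := fun i => (Fintype.equivFin τ i).2
    have i₀_neg : ∀ z, i₀ (-z) = i₀ z := fun z => by simp only [i₀, major_neg]
    have sg_neg : ∀ z, sg (-z) = -sg z := by
      intro z
      simp only [sg, i₀_neg, share_neg, neg_neg]
      ring
    -- Vectors with few blocks get absolute values `1, ..., N - t - 1`; the others encode a majority
    -- colour by `N - t, ..., N - 1`. The sign records the last sign or the person holding the
    -- majority.
    let l : (Fin N → ℤ) → ℤ := fun z =>
      if (signBlocks (ext z) N).1 + t < N then (signBlocks (ext z) N).1 * (signBlocks (ext z) N).2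
      else sg z * ((N - t + idx (i₀ z) : ℕ) : ℤ)
    have l_neg : ∀ z, l (-z) = -l z := by
      intro z
      simp only [l, ext_neg, signBlocks_neg, sg_neg, i₀_neg]
      split_ifs <;> ring
    have few : ∀ z, IsSignVector z → z ≠ 0 →
        1 ≤ (signBlocks (ext z) N).1 ∧
          ((signBlocks (ext z) N).2 = 1 ∨ (signBlocks (ext z) N).2 = -1) := by
      intro z hz hz0
      refine (signBlocks_snd (ext z) (ext_sign z hz) N).resolve_left ?_
      rintro ⟨h, -⟩
      refine hz0 (funext fun j => ?_)
      have := h j j.2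
      simpa [ext] using this
    have many : ∀ z, IsSignVector z → z ≠ 0 → ¬ (signBlocks (ext z) N).1 + t < N →
        (sg z = 1 ∧ tot (i₀ z) < 2 * (share z 1 (i₀ z)).card) ∨
          (sg z = -1 ∧ tot (i₀ z) < 2 * (share z (-1) (i₀ z)).card) := by
      intro z hz hz0 h
      have h1 : major z (i₀ z) := Classical.epsilon_spec (hcon z hz hz0 (not_lt.1 h))
      have h2 := share_add z (i₀ z)
      simp only [sg]
      rcases h1 with h1 | h1
      · left
        rw [if_pos h1, if_neg (by omega)]
        exact ⟨rfl, h1⟩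
      · right
        rw [if_neg (by omega), if_pos h1]
        exact ⟨rfl, h1⟩
    have abs_few : ∀ z, IsSignVector z → z ≠ 0 → (signBlocks (ext z) N).1 + t < N →
        |l z| = (signBlocks (ext z) N).1 := by
      intro z hz hz0 h
      simp only [l, if_pos h, abs_mul, Nat.abs_cast]
      rcases (few z hz hz0).2 with h | h <;> simp [h]
    have abs_many : ∀ z, IsSignVector z → z ≠ 0 → ¬ (signBlocks (ext z) N).1 + t < N →
        |l z| = (N - t + idx (i₀ z) : ℕ) := by
      intro z hz hz0 h
      simp only [l, if_neg h, abs_mul, Nat.abs_cast]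
      rcases many z hz hz0 h with h | h <;> simp [h.1]
    obtain ⟨A, B, hA, hB, hA0, hAB, hl⟩ := exists_complementary_pair (by omega) l l_neg (by
      intro z hz hz0
      rw [← abs_pos]
      by_cases h : (signBlocks (ext z) N).1 + t < N
      · have := (few z hz hz0).1
        rw [abs_few z hz hz0 h]
        omega
      · have := idx_lt (i₀ z)
        rw [abs_many z hz hz0 h]
        omega)
    have hB0 : B ≠ 0 := by
      rintro rfl
      refine hA0 (funext fun j => ?_)
      by_contra h
      exact h (hAB j h).symm
    have hext : ∀ j, ext A j ≠ 0 → ext B j = ext A j := by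
      intro j hj
      simp only [ext] at hj ⊢
      split_ifs at hj ⊢ with h
      · exact hAB _ hj
      · exact absurd rfl hj
    have habs : |l A| = |l B| := by rw [hl, abs_neg]
    -- With few blocks on both sides, equal counts force equal last signs. The mixed cases have
    -- different absolute values. With many blocks on both sides, opposite persons would each have
    -- more than half of the same colour in `B`, whose shares contain those of `A`.
    by_cases hA' : (signBlocks (ext A) N).1 + t < N <;>
      by_cases hB' : (signBlocks (ext B) N).1 + t < N
    · rw [abs_few A hA hA0 hA', abs_few B hB hB0 hB'] at habs
      have heq := (signBlocks_lt_or_eq hext N).resolve_left (by omega)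
      simp only [l, if_pos hA', if_pos hB', heq] at hl
      have h1 := few B hB hB0
      rcases h1.2 with h | h <;> rw [h] at hl <;> omega
    · rw [abs_few A hA hA0 hA', abs_many B hB hB0 hB'] at habs
      omega
    · rw [abs_many A hA hA0 hA', abs_few B hB hB0 hB'] at habs
      omega
    · rw [abs_many A hA hA0 hA', abs_many B hB hB0 hB'] at habs
      have hi : i₀ A = i₀ B := by
        have h1 : idx (i₀ A) = idx (i₀ B) := by omega
        exact (Fintype.equivFin τ).injective (Fin.ext h1)
      simp only [l, if_neg hA', if_neg hB', hi] at hl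
      have hpos : ((N - t + idx (i₀ B) : ℕ) : ℤ) ≠ 0 := by omega
      rw [← neg_mul] at hl
      have hs := mul_right_cancel₀ hpos hl
      have hsub : ∀ s : ℤ, s ≠ 0 → share A s (i₀ B) ⊆ share B s (i₀ B) := by
        intro s hs j hj
        simp only [share, Finset.mem_filter] at hj ⊢
        refine ⟨hj.1, hj.2.1, ?_⟩
        rw [hext j, hj.2.2]
        intro h
        rw [h, mul_zero] at hj
        exact hs hj.2.2.symm
      have hsub1 := Finset.card_le_card (hsub 1 (by norm_num))
      have hsub2 := Finset.card_le_card (hsub (-1) (by norm_num))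
      have htot := share_add B (i₀ B)
      have hmA := many A hA hA0 hA'
      have hmB := many B hB hB0 hB'
      rw [hi] at hmA
      omega
  -- Zeros, of which there are at most `t`, are filled in arbitrarily.
  let z' : ℕ → ℤ := fun j => if ext z j = 0 then 1 else ext z j
  have hz' : ∀ j, z' j = 1 ∨ z' j = -1 := by
    intro j
    simp only [z']
    split_ifs with h
    · exact Or.inl rfl
    · exact (ext_sign z hz j).resolve_left h
  have hpow : ∀ j : ℕ, ((-1 : ℤ) ^ j = 1 ∨ (-1 : ℤ) ^ j = -1) := neg_one_pow_eq_or ℤ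
  refine ⟨fun j => (-1) ^ j * z' j, ?_, ?_, ?_⟩
  · intro j
    rcases hpow j with h | h <;> rcases hz' j with h' | h' <;> simp [h, h']
  · have h1 : (signBlocks (ext z) N).1 ≤ (signBlocks z' N).1 := by
      rcases signBlocks_lt_or_eq (A := ext z) (B := z') (fun j hj => by simp [z', hj]) N with h | h
      · exact h.le
      · rw [h]
    obtain ⟨m, rfl⟩ : ∃ m, N = m + 1 := ⟨N - 1, by omega⟩
    rw [signBlocks_of_ne_zero z' (fun j => by rcases hz' j with h | h <;> rw [h] <;> decide) m] at h1
    -- After the twist, a cut is a place where `z'` does not change sign.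
    have h2 : ((Finset.range (m + 1 - 1)).filter fun j =>
        (-1) ^ (j + 1) * z' (j + 1) ≠ (-1) ^ j * z' j) =
        (Finset.range m).filter fun j => ¬ z' (j + 1) ≠ z' j := by
      refine Finset.filter_congr fun j _ => ?_
      rw [pow_succ]
      rcases hpow j with h | h <;> rcases hz' j with h' | h' <;> rcases hz' (j + 1) with h'' | h'' <;>
        simp [h, h', h'']
    rw [h2]
    have h3 := Finset.card_filter_add_card_filter_not (s := Finset.range m)
      (fun j => z' (j + 1) ≠ z' j)
    rw [Finset.card_range] at h3
    dsimp only at h1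
    omega
  · have hzero : ∑ i, (share z 0 i).card ≤ t := by
      have h1 : ∑ i, (share z 0 i).card = ((Finset.range N).filter fun j => ¬ ext z j ≠ 0).card := by
        rw [Finset.card_eq_sum_card_fiberwise (f := c) (t := Finset.univ) (by simp)]
        refine Finset.sum_congr rfl fun i _ => ?_
        congr 1
        ext j
        simp only [share, Finset.mem_filter]
        simp
        tauto
      have h2 := Finset.card_filter_add_card_filter_not (s := Finset.range N)
        (fun j => ext z j ≠ 0)
      have h3 := signBlocks_le (ext z) N
      rw [Finset.card_range] at h2
      omega
    -- Without a majority the shares of a colour differ by at most its number of zeros; filling in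
    -- the zeros costs at most that number again.
    have hterm : ∀ i, |∑ j ∈ (Finset.range N).filter (fun j => c j = i), (-1) ^ j * z' j| ≤
        2 * ((share z 0 i).card : ℤ) := by
      intro i
      have hcard : ∀ s : ℤ, ((share z s i).card : ℤ) =
          ∑ j ∈ (Finset.range N).filter (fun j => c j = i),
            if (-1) ^ j * ext z j = s then 1 else 0 := by
        intro s
        rw [Finset.sum_boole, Finset.filter_filter]
      have h1 := hcard 1
      have h2 := hcard (-1)
      have h3 := hcard 0
      have h4 : (tot i : ℤ) = ∑ j ∈ (Finset.range N).filter (fun j => c j = i), 1 := by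
        simp [tot]
      have h5 : (tot i : ℤ) = (share z 1 i).card + (share z (-1) i).card + (share z 0 i).card := by
        rw [h1, h2, h3, h4, ← Finset.sum_add_distrib, ← Finset.sum_add_distrib]
        refine Finset.sum_congr rfl fun j _ => ?_
        rcases hpow j with h | h <;> rcases ext_sign z hz j with h' | h' | h' <;> simp [h, h']
      have h6 : |∑ j ∈ (Finset.range N).filter (fun j => c j = i), (-1) ^ j * z' j -
          (((share z 1 i).card : ℤ) - (share z (-1) i).card)| ≤ (share z 0 i).card := by
        rw [h1, h2, h3, ← Finset.sum_sub_distrib, ← Finset.sum_sub_distrib]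
        refine (Finset.abs_sum_le_sum_abs _ _).trans (Finset.sum_le_sum fun j _ => ?_)
        rcases hpow j with h | h <;> rcases ext_sign z hz j with h' | h' | h' <;>
          simp [h, h', z']
      have h7 := hzm i
      simp only [major, not_or, not_lt] at h7
      rw [abs_le] at h6 ⊢
      omega
    calc _ ≤ ∑ i, 2 * ((share z 0 i).card : ℤ) := Finset.sum_le_sum fun i _ => hterm i
      _ = 2 * ((∑ i, (share z 0 i).card : ℕ) : ℤ) := by
        rw [← Finset.mul_sum]; push_cast; rfl
      _ ≤ _ := by omega

/-! ### Seminorms on the lattice -/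

section Seminorm

variable {n : ℕ} (d : AddGroupSeminorm (Fin n → ℤ))

theorem AddGroupSeminorm.map_zsmul_le_abs_mul {E : Type*} [AddGroup E] (d : AddGroupSeminorm E)
    (k : ℤ) (v : E) : d (k • v) ≤ |(k : ℝ)| * d v := by
  have hnat : ∀ m : ℕ, d (m • v) ≤ m * d v := by
    intro m
    induction m with
    | zero => simp
    | succ m ih =>
      rw [succ_nsmul]
      refine (map_add_le_add d _ _).trans ?_
      push_cast
      linarith
  rcases k.natAbs_eq with h | h
  · rw [h, natCast_zsmul]
    simpa using hnat k.natAbs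
  · rw [h, neg_zsmul, natCast_zsmul, map_neg_eq_map]
    simpa using hnat k.natAbs

theorem AddGroupSeminorm.map_sum_le_sum {E ι : Type*} [AddCommGroup E] (d : AddGroupSeminorm E)
    (s : Finset ι) (f : ι → E) : d (∑ i ∈ s, f i) ≤ ∑ i ∈ s, d (f i) :=
  Finset.le_sum_of_subadditive d (map_zero d).le (map_add_le_add d) s f

theorem seminorm_mulVec_le (A : Matrix (Fin n) (Fin n) ℤ) (k : Fin n → ℤ) {r K : ℝ}
    (hA : ∀ i, d (A.col i) ≤ r) (hk : ∀ i, |(k i : ℝ)| ≤ K) :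
    d (A.mulVec k) ≤ n * (K * r) := by
  have h : A.mulVec k = ∑ i, k i • A.col i := by
    funext j
    simp [Matrix.mulVec, dotProduct, mul_comm]
  rw [h]
  refine (d.map_sum_le_sum _ _).trans ((Finset.sum_le_card_nsmul _ _ (K * r) fun i _ => ?_).trans ?_)
  · refine (d.map_zsmul_le_abs_mul _ _).trans ?_
    exact mul_le_mul (hk i) (hA i) (apply_nonneg d _) ((abs_nonneg _).trans (hk i))
  · simp

end Seminorm

/-! ### Sublattices of small index and integral coordinates -/

section Lattice

variable {n : ℕ}

/-- Thus `A.cramer` gives coordinates with respect to the columns, multiplied by `A.det` so that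
they stay integral. -/
theorem cramer_mulVec_self (A : Matrix (Fin n) (Fin n) ℤ) (k : Fin n → ℤ) :
    A.cramer (A.mulVec k) = A.det • k := by
  rw [Matrix.cramer_eq_adjugate_mulVec, Matrix.mulVec_mulVec, Matrix.adjugate_mul,
    Matrix.smul_mulVec, Matrix.one_mulVec]

theorem mulVec_injective_of_det_ne_zero {A : Matrix (Fin n) (Fin n) ℤ} (hA : A.det ≠ 0) :
    Function.Injective A.mulVec := by
  intro k k' h
  have h1 := congrArg A.cramer h
  rw [cramer_mulVec_self, cramer_mulVec_self] at h1
  exact smul_right_injective _ hA h1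

/-- A set from which every lattice point is reached by successive steps contains the columns of a
nonsingular matrix. -/
theorem exists_det_ne_zero (S : Set (Fin n → ℤ))
    (hS : ∀ g : Fin n → ℤ, ∃ (N : ℕ) (h : ℕ → Fin n → ℤ), h 0 = 0 ∧ h N = g ∧
      ∀ j < N, h (j + 1) - h j ∈ S) :
    ∃ A : Matrix (Fin n) (Fin n) ℤ, A.det ≠ 0 ∧ ∀ i, A.col i ∈ S := by
  let ratCast : (Fin n → ℤ) →+ (Fin n → ℚ) := (Int.castAddHom ℚ).compLeft (Fin n)
  have h_cast : ∀ g, ratCast g ∈ Submodule.span ℚ (ratCast '' S) := by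
    intro g
    obtain ⟨N, h, h0, rfl, hs⟩ := hS g
    have key : ∀ j ≤ N, ratCast (h j) ∈ Submodule.span ℚ (ratCast '' S) := by
      intro j
      induction j with
      | zero => intro _; rw [h0, map_zero]; exact Submodule.zero_mem _
      | succ j ih =>
        intro hj
        have h1 : h (j + 1) = h j + (h (j + 1) - h j) := by abel
        rw [h1, map_add]
        exact Submodule.add_mem _ (ih (by omega))
          (Submodule.subset_span ⟨_, hs j (by omega), rfl⟩)
    exact key N le_rfl
  have htop : ⊤ ≤ Submodule.span ℚ (ratCast '' S) := by
    rw [← (Pi.basisFun ℚ (Fin n)).span_eq, Submodule.span_le]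
    rintro _ ⟨i, rfl⟩
    have h1 : (Pi.basisFun ℚ (Fin n)) i = ratCast (Pi.single i 1) := by
      funext j
      simp [ratCast, Pi.single_apply]
    rw [h1]
    exact h_cast _
  let b := Module.Basis.ofSpan htop
  have : Fintype ((linearIndepOn_empty ℚ id).extend (Set.empty_subset (ratCast '' S))) :=
    FiniteDimensional.fintypeBasisIndex b
  have hcard : Fintype.card ((linearIndepOn_empty ℚ id).extend (Set.empty_subset (ratCast '' S))) =
      Fintype.card (Fin n) := by
    rw [← Module.finrank_eq_card_basis b]
    simp
  let b' := b.reindex (Fintype.equivOfCardEq hcard)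
  have hb' : ∀ i, ∃ v ∈ S, ratCast v = b' i := by
    intro i
    have h1 : b' i ∈ ratCast '' S := by
      apply Module.Basis.ofSpan_subset htop
      rw [Module.Basis.reindex_apply]
      exact ⟨_, rfl⟩
    exact h1
  choose v hv hvb using hb'
  refine ⟨(Matrix.of v).transpose, ?_, fun i => hv i⟩
  rw [Matrix.det_transpose]
  intro hdet
  have h2 : (Matrix.of fun i => b' i).det = 0 := by
    have h3 : (Matrix.of fun i => b' i) = (Matrix.of v).map (Int.castRingHom ℚ) := by
      ext i j
      rw [Matrix.of_apply, ← hvb]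
      rfl
    rw [h3, ← RingHom.mapMatrix_apply, ← RingHom.map_det, hdet, map_zero]
  have h4 := b'.linearIndependent
  obtain ⟨k, hk0, hk⟩ := Matrix.exists_vecMul_eq_zero_iff.2 h2
  rw [Fintype.linearIndependent_iff] at h4
  refine hk0 (funext fun i => h4 k ?_ i)
  rw [← hk]
  funext j
  simp [Matrix.vecMul, dotProduct]

/-- Among the matrices with columns in a finite set, one with determinant of maximal absolute value
has the property that the elements of the set have coordinates of absolute value at most `1` with
respect to its columns. -/
theorem exists_cramer_le (F : Finset (Fin n → ℤ))
    (hF : ∃ A : Matrix (Fin n) (Fin n) ℤ, A.det ≠ 0 ∧ ∀ i, A.col i ∈ F) :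
    ∃ A : Matrix (Fin n) (Fin n) ℤ, A.det ≠ 0 ∧ (∀ i, A.col i ∈ F) ∧
      ∀ s ∈ F, ∀ i, |A.cramer s i| ≤ |A.det| := by
  obtain ⟨A₀, hA₀, hA₀F⟩ := hF
  obtain ⟨v, hv, hmax⟩ := Finset.exists_max_image (Fintype.piFinset fun _ : Fin n => F)
    (fun v => |(Matrix.of v).transpose.det|) ⟨fun i => A₀.col i, by simpa using hA₀F⟩
  have hmax' : ∀ B : Matrix (Fin n) (Fin n) ℤ, (∀ i, B.col i ∈ F) →
      |B.det| ≤ |(Matrix.of v).transpose.det| :=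
    fun B hB => hmax (fun i => B.col i) (by simpa using hB)
  rw [Fintype.mem_piFinset] at hv
  refine ⟨(Matrix.of v).transpose, ?_, hv, fun s hs i => ?_⟩
  · rw [← abs_pos]
    exact (abs_pos.2 hA₀).trans_le (hmax' A₀ hA₀F)
  · rw [Matrix.cramer_apply]
    refine hmax' _ fun j => ?_
    rcases eq_or_ne j i with rfl | hji
    · have : ((Matrix.of v).transpose.updateCol j s).col j = s := by
        funext m; simp [Matrix.col]
      rw [this]; exact hs
    · have : ((Matrix.of v).transpose.updateCol i s).col j = v j := by
        funext m; simp [Matrix.col, hji]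
      rw [this]; exact hv j

/-- The sublattice generated by the columns of a matrix. -/
def columnLattice (A : Matrix (Fin n) (Fin n) ℤ) : AddSubgroup (Fin n → ℤ) :=
  A.mulVecLin.toAddMonoidHom.range

theorem mem_columnLattice {A : Matrix (Fin n) (Fin n) ℤ} {g : Fin n → ℤ} :
    g ∈ columnLattice A ↔ ∃ k, A.mulVec k = g := Iff.rfl

/-- The number of lattice points in balls of radius `R`, up to a bounded change of the radius, is
for arbitrarily large `R` at most about `Ω R ^ n`. -/
def HasLowerVolumeBound (d : AddGroupSeminorm (Fin n → ℤ)) (Ω : ℝ) : Prop :=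
  ∃ C : ℝ, ∀ c > Ω, ∀ R₀ : ℝ, ∃ R > R₀, ∀ T : Finset (Fin n → ℤ), (∀ g ∈ T, d g + C < R) →
    (T.card : ℝ) ≤ c * R ^ n

/-- Packing: the points `f + A k` with `k` in a box of side about `R / (n r)` are distinct and lie
in a ball of radius about `R`. Comparing their number with `c R ^ n` for large `R` bounds `F.card`.
-/
theorem card_representatives_le (hn : 1 ≤ n) {d : AddGroupSeminorm (Fin n → ℤ)} {Ω : ℝ}
    (hd : HasLowerVolumeBound d Ω) {A : Matrix (Fin n) (Fin n) ℤ} (hA : A.det ≠ 0) {r : ℝ}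
    (hr : 0 < r) (hAr : ∀ i, d (A.col i) ≤ r) (F : Finset (Fin n → ℤ))
    (hF : ∀ f ∈ F, ∀ f' ∈ F, f - f' ∈ columnLattice A → f = f') :
    (F.card : ℝ) ≤ (n * r) ^ n * Ω := by
  by_contra hcon
  push Not at hcon
  have hn0 : (0 : ℝ) < n := by exact_mod_cast hn
  have hnr : 0 < n * r := by positivity
  obtain ⟨C, hC⟩ := hd
  obtain ⟨c, hc, hcF⟩ : ∃ c > Ω, (n * r) ^ n * c < F.card := by
    have h1 : Ω < F.card / (n * r) ^ n := by rw [lt_div_iff₀ (by positivity)]; linarith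
    obtain ⟨c, hc1, hc2⟩ := exists_between h1
    refine ⟨c, hc1, ?_⟩
    rw [lt_div_iff₀ (by positivity)] at hc2
    linarith
  -- A margin independent of `R` that absorbs the change of radius and the seminorms of all
  -- representatives.
  set C₀ : ℝ := |C| + ∑ f ∈ F, d f + 1 with hC₀
  have hsum : 0 ≤ ∑ f ∈ F, d f := Finset.sum_nonneg fun f _ => apply_nonneg d f
  have hlim : Tendsto (fun R : ℝ => (F.card : ℝ) * (1 - C₀ / R) ^ n) atTop
      (𝓝 ((F.card : ℝ) * (1 - 0) ^ n)) :=
    (((tendsto_const_nhds.div_atTop tendsto_id).const_sub 1).pow n).const_mul _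
  rw [sub_zero, one_pow, mul_one] at hlim
  obtain ⟨R₁, hR₁⟩ := eventually_atTop.1 (hlim.eventually_const_lt hcF)
  obtain ⟨R, hR, hT⟩ := hC c hc (max R₁ C₀)
  have hR1 : R₁ ≤ R := (le_max_left _ _).trans hR.le
  have hR0 : C₀ < R := (le_max_right _ _).trans_lt hR
  have hC₀pos : 0 < C₀ := by positivity
  have hRpos : 0 < R := hC₀pos.trans hR0
  set K : ℕ := ⌊(R - C₀) / (n * r)⌋₊ with hK
  have hKle : (K : ℝ) * (n * r) ≤ R - C₀ := by
    rw [← le_div_iff₀ hnr]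
    exact Nat.floor_le (div_nonneg (by linarith) hnr.le)
  have hKlt : (R - C₀) / (n * r) < K + 1 := Nat.lt_floor_add_one _
  let f : (Fin n → ℤ) × (Fin n → ℕ) → (Fin n → ℤ) := fun p => p.1 + A.mulVec fun i => (p.2 i : ℤ)
  let P := F ×ˢ Fintype.piFinset fun _ : Fin n => Finset.range (K + 1)
  have hinj : Set.InjOn f P := by
    rintro ⟨g, k⟩ hg ⟨g', k'⟩ hg' h
    simp only [P, Finset.coe_product, Set.mem_prod, Finset.mem_coe] at hg hg'
    simp only [f] at h
    have h1 : g = g' := by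
      refine hF g hg.1 g' hg'.1
        (mem_columnLattice.2 ⟨(fun i => (k' i : ℤ)) - fun i => (k i : ℤ), ?_⟩)
      rw [Matrix.mulVec_sub, sub_eq_sub_iff_add_eq_add, add_comm, ← h, add_comm]
    subst h1
    have h2 := mulVec_injective_of_det_ne_zero hA (add_left_cancel h)
    refine Prod.ext rfl (funext fun i => ?_)
    exact_mod_cast congrFun h2 i
  have hcard : (P.image f).card = F.card * (K + 1) ^ n := by
    rw [Finset.card_image_of_injOn hinj, Finset.card_product, Fintype.card_piFinset]
    simp
  have hle := hT (P.image f) (by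
    intro g hg
    obtain ⟨⟨g, k⟩, hp, rfl⟩ := Finset.mem_image.1 hg
    rw [Finset.mem_product, Fintype.mem_piFinset] at hp
    have h1 : d (A.mulVec fun i => (k i : ℤ)) ≤ n * (K * r) := by
      refine seminorm_mulVec_le d A _ hAr fun i => ?_
      have := hp.2 i
      rw [Finset.mem_range, Nat.lt_succ_iff] at this
      simpa using this
    have h2 : d g ≤ ∑ f ∈ F, d f :=
      Finset.single_le_sum (f := fun f => d f) (fun f _ => apply_nonneg d f) hp.1
    have h3 := map_add_le_add d g (A.mulVec fun i => (k i : ℤ))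
    have h4 := le_abs_self C
    simp only [f]
    linarith)
  rw [hcard] at hle
  have hfin : (F.card : ℝ) * (1 - C₀ / R) ^ n ≤ (n * r) ^ n * c := by
    have h1 : (F.card : ℝ) * ((R - C₀) / (n * r)) ^ n ≤ c * R ^ n := by
      refine le_trans ?_ hle
      push_cast
      refine mul_le_mul_of_nonneg_left (pow_le_pow_left₀ ?_ hKlt.le n) (Nat.cast_nonneg _)
      exact div_nonneg (by linarith) hnr.le
    have h2 : (1 - C₀ / R) = (R - C₀) / R := by field_simp
    rw [h2, div_pow, ← mul_div_assoc, div_le_iff₀ (by positivity)]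
    rw [div_pow, ← mul_div_assoc, div_le_iff₀ (by positivity)] at h1
    linarith
  exact absurd (hR₁ R hR1) (not_lt.2 hfin)

theorem card_quotient_columnLattice_le (hn : 1 ≤ n) {d : AddGroupSeminorm (Fin n → ℤ)} {Ω : ℝ}
    (hd : HasLowerVolumeBound d Ω) {A : Matrix (Fin n) (Fin n) ℤ} (hA : A.det ≠ 0) {r : ℝ}
    (hr : 0 < r) (hAr : ∀ i, d (A.col i) ≤ r) :
    Finite ((Fin n → ℤ) ⧸ columnLattice A) ∧
      (Nat.card ((Fin n → ℤ) ⧸ columnLattice A) : ℝ) ≤ (n * r) ^ n * Ω := by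
  classical
  have key : ∀ P : Finset ((Fin n → ℤ) ⧸ columnLattice A), (P.card : ℝ) ≤ (n * r) ^ n * Ω := by
    intro P
    have h1 := card_representatives_le hn hd hA hr hAr (P.image Quotient.out) (by
      intro f hf f' hf' hff'
      obtain ⟨p, -, rfl⟩ := Finset.mem_image.1 hf
      obtain ⟨p', -, rfl⟩ := Finset.mem_image.1 hf'
      congr 1
      rw [← QuotientAddGroup.out_eq' p, ← QuotientAddGroup.out_eq' p', eq_comm,
        QuotientAddGroup.eq]
      rw [neg_add_eq_sub]
      exact hff')
    rwa [Finset.card_image_of_injective _ Quotient.out_injective] at h1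
  have hfin : Finite ((Fin n → ℤ) ⧸ columnLattice A) := by
    by_contra hinf
    rw [not_finite_iff_infinite] at hinf
    obtain ⟨P, hP⟩ := Infinite.exists_subset_card_eq ((Fin n → ℤ) ⧸ columnLattice A)
      (⌊(n * r) ^ n * Ω⌋₊ + 1)
    have h1 := key P
    rw [hP] at h1
    have h2 := Nat.lt_floor_add_one ((n * r) ^ n * Ω)
    push_cast at h1
    linarith
  refine ⟨hfin, ?_⟩
  have := Fintype.ofFinite ((Fin n → ℤ) ⧸ columnLattice A)
  rw [Nat.card_eq_fintype_card]
  exact key Finset.univ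

/-- Two elements of `F` in one coset differ by `A k` with all `|k i| ≤ 2`, which leaves `5 ^ n`
choices. -/
theorem card_le_mul_card_quotient {A : Matrix (Fin n) (Fin n) ℤ} (hA : A.det ≠ 0)
    [Finite ((Fin n → ℤ) ⧸ columnLattice A)] (F : Finset (Fin n → ℤ))
    (hF : ∀ s ∈ F, ∀ i, |A.cramer s i| ≤ |A.det|) :
    F.card ≤ 5 ^ n * Nat.card ((Fin n → ℤ) ⧸ columnLattice A) := by
  classical
  have := Fintype.ofFinite ((Fin n → ℤ) ⧸ columnLattice A)
  rw [Nat.card_eq_fintype_card]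
  let π : (Fin n → ℤ) → (Fin n → ℤ) ⧸ columnLattice A := QuotientAddGroup.mk
  refine (Finset.card_le_mul_card_image (f := π) F (5 ^ n) ?_).trans
    (Nat.mul_le_mul_left _ (Finset.card_le_univ _))
  intro q hq
  obtain ⟨s, hs, rfl⟩ := Finset.mem_image.1 hq
  have hsub : F.filter (fun x => π x = π s) ⊆
      (Fintype.piFinset fun _ : Fin n => Finset.Icc (-2 : ℤ) 2).image fun k => s + A.mulVec k := by
    intro x hx
    rw [Finset.mem_filter] at hx
    obtain ⟨k, hk⟩ := mem_columnLattice.1 (QuotientAddGroup.eq.1 hx.2.symm)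
    refine Finset.mem_image.2 ⟨k, ?_, by rw [hk]; abel⟩
    rw [Fintype.mem_piFinset]
    intro i
    have h1 := congrFun (cramer_mulVec_self A k) i
    rw [hk, map_add, map_neg, Pi.add_apply, Pi.neg_apply, Pi.smul_apply, smul_eq_mul] at h1
    have h2 := hF x hx.1 i
    have h3 := hF s hs i
    have h4 : |A.det| * |k i| ≤ |A.det| * 2 := by
      rw [← abs_mul, ← h1]
      refine (abs_add_le _ _).trans ?_
      rw [abs_neg]
      linarith
    have h5 := le_of_mul_le_mul_left h4 (abs_pos.2 hA)
    rw [Finset.mem_Icc]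
    exact abs_le.1 h5
  refine (Finset.card_le_card hsub).trans (Finset.card_image_le.trans ?_)
  rw [Fintype.card_piFinset]
  simp

/-- Until it is everything, the set gains an element at each step. -/
theorem eq_univ_of_stabilizing {Q : Type*} [Finite Q] (W : ℕ → Set Q)
    (hmono : ∀ k, W k ⊆ W (k + 1)) (hstab : ∀ k, W (k + 1) ⊆ W k → W k = Set.univ) :
    W (Nat.card Q) = Set.univ := by
  have key : ∀ k, k ≤ (W k).ncard ∨ W k = Set.univ := by
    intro k
    induction k with
    | zero => exact Or.inl (Nat.zero_le _)
    | succ k ih =>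
      by_cases h : W (k + 1) ⊆ W k
      · right
        exact Set.univ_subset_iff.1 ((hstab k h).symm.subset.trans (hmono k))
      · rcases ih with ih | ih
        · left
          have := Set.ncard_lt_ncard ((hmono k).ssubset_of_not_superset h)
          omega
        · exact absurd (ih ▸ Set.subset_univ _) h
  rcases key (Nat.card Q) with h | h
  · refine Set.eq_of_subset_of_ncard_le (Set.subset_univ _) ?_
    rwa [Set.ncard_univ]
  · exact h

/-- If `S` generates the lattice, then every coset of the sublattice of index `q` spanned by the
columns of `A` has a representative that is a sum of `q` elements of `S`. Only the resulting
bounds for the seminorm and the coordinates are recorded. -/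
theorem exists_short_representative {d : AddGroupSeminorm (Fin n → ℤ)}
    {A : Matrix (Fin n) (Fin n) ℤ} [Finite ((Fin n → ℤ) ⧸ columnLattice A)] {r : ℝ} (hr : 0 ≤ r)
    (hS : ∀ g : Fin n → ℤ, ∃ (N : ℕ) (h : ℕ → Fin n → ℤ), h 0 = 0 ∧ h N = g ∧
      ∀ j < N, d (h (j + 1) - h j) ≤ r)
    (hcr : ∀ s, d s ≤ r → ∀ i, |A.cramer s i| ≤ |A.det|) (g : Fin n → ℤ) :
    ∃ w k, g = w + A.mulVec k ∧
      d w ≤ Nat.card ((Fin n → ℤ) ⧸ columnLattice A) * r ∧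
      ∀ i, |A.cramer w i| ≤ Nat.card ((Fin n → ℤ) ⧸ columnLattice A) * |A.det| := by
  let π : (Fin n → ℤ) → (Fin n → ℤ) ⧸ columnLattice A := QuotientAddGroup.mk
  let W : ℕ → Set ((Fin n → ℤ) ⧸ columnLattice A) := fun m =>
    {p | ∃ w, π w = p ∧ d w ≤ m * r ∧ ∀ i, |A.cramer w i| ≤ m * |A.det|}
  have hadd : ∀ m p s, p ∈ W m → d s ≤ r → p + π s ∈ W (m + 1) := by
    rintro m _ s ⟨w, rfl, hw, hw'⟩ hs
    refine ⟨w + s, rfl, ?_, fun i => ?_⟩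
    · refine (map_add_le_add d w s).trans ?_
      push_cast
      linarith
    · rw [map_add, Pi.add_apply]
      refine (abs_add_le _ _).trans ?_
      push_cast
      have h1 := hw' i
      have h2 := hcr s hs i
      linarith
  have hmono : ∀ m, W m ⊆ W (m + 1) := by
    intro m p hp
    have := hadd m p 0 hp (by simpa using hr)
    simpa [π] using this
  have hzero : ∀ m, (0 : (Fin n → ℤ) ⧸ columnLattice A) ∈ W m := by
    intro m
    refine ⟨0, rfl, ?_, fun i => ?_⟩
    · rw [map_zero]; positivity
    · rw [map_zero]; simp; positivity
  have htop := eq_univ_of_stabilizing W hmono (by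
    intro m hm
    refine Set.eq_univ_of_forall fun p => ?_
    obtain ⟨g, rfl⟩ := QuotientAddGroup.mk_surjective p
    obtain ⟨N, h, h0, rfl, hs⟩ := hS g
    -- Once `W m` stops growing it is closed under adding steps, so the chain never leaves it.
    have key : ∀ j ≤ N, π (h j) ∈ W m := by
      intro j
      induction j with
      | zero => intro _; rw [h0]; exact hzero m
      | succ j ih =>
        intro hj
        have h1 := hm (hadd m _ _ (ih (by omega)) (hs j (by omega)))
        have h2 : π (h j) + π (h (j + 1) - h j) = π (h (j + 1)) := by
          change π (h j + (h (j + 1) - h j)) = _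
          congr 1
          abel
        rwa [h2] at h1
    exact key N le_rfl)
  obtain ⟨w, hw, hw1, hw2⟩ : π g ∈ W (Nat.card ((Fin n → ℤ) ⧸ columnLattice A)) := by
    rw [htop]; trivial
  obtain ⟨k, hk⟩ := mem_columnLattice.1 (QuotientAddGroup.eq.1 hw)
  exact ⟨w, k, by rw [hk]; abel, hw1, hw2⟩

/-- A bound for the seminorm of `δ` in terms of the coordinates of `2 δ`. -/
theorem seminorm_le_of_cramer_two_smul_le {d : AddGroupSeminorm (Fin n → ℤ)}
    {A : Matrix (Fin n) (Fin n) ℤ} (hA : A.det ≠ 0)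
    [Finite ((Fin n → ℤ) ⧸ columnLattice A)] {r : ℝ} (hr : 0 ≤ r)
    (hAr : ∀ i, d (A.col i) ≤ r)
    (hS : ∀ g : Fin n → ℤ, ∃ (N : ℕ) (h : ℕ → Fin n → ℤ), h 0 = 0 ∧ h N = g ∧
      ∀ j < N, d (h (j + 1) - h j) ≤ r)
    (hcr : ∀ s, d s ≤ r → ∀ i, |A.cramer s i| ≤ |A.det|) (δ : Fin n → ℤ) (t : ℕ)
    (hδ : ∀ i, |A.cramer (2 • δ) i| ≤ 2 * t * |A.det|) :
    d δ ≤ (n * (t + Nat.card ((Fin n → ℤ) ⧸ columnLattice A)) +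
      Nat.card ((Fin n → ℤ) ⧸ columnLattice A)) * r := by
  obtain ⟨w, k, rfl, hw, hw'⟩ := exists_short_representative hr hS hcr δ
  set q := Nat.card ((Fin n → ℤ) ⧸ columnLattice A)
  -- The point `δ` has coordinates at most `t` and `w` at most `q`, so their difference `k` has at
  -- most `t + q`.
  have hk : ∀ i, |(k i : ℝ)| ≤ (t + q : ℝ) := by
    intro i
    have h1 := hδ i
    have h2 := hw' i
    rw [map_nsmul, map_add, cramer_mulVec_self, Pi.smul_apply, Pi.add_apply, Pi.smul_apply,
      smul_eq_mul, nsmul_eq_mul, abs_mul] at h1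
    have h3 : |A.det| * |k i| ≤ |A.det| * (t + q) := by
      rw [← abs_mul]
      have h4 := abs_sub (A.cramer w i + A.det * k i) (A.cramer w i)
      rw [add_sub_cancel_left] at h4
      simp only [Nat.cast_ofNat, Nat.abs_ofNat] at h1
      linarith
    have h5 := le_of_mul_le_mul_left h3 (abs_pos.2 hA)
    exact_mod_cast h5
  have h1 := seminorm_mulVec_le d A k hAr hk
  have h2 := map_add_le_add d w (A.mulVec k)
  linarith

end Lattice

/-! ### Coarse geodesics and their division into two shares -/

/-- Every lattice point is reached from the origin along a chain with arbitrarily many short steps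
whose total length exceeds the seminorm as little as desired, and such that the seminorm along
any part of the chain exceeds the length of that part by hardly more than `2 D`. -/
def IsCoarselyGeodesic {n : ℕ} (d : AddGroupSeminorm (Fin n → ℤ)) (D : ℝ) : Prop :=
  ∀ (g : Fin n → ℤ) (ε : ℝ), 0 < ε → ∀ N₀ : ℕ, ∃ N ≥ N₀, ∃ (h : ℕ → Fin n → ℤ) (ℓ : ℕ → ℝ),
    h 0 = 0 ∧ h N = g ∧ (∀ j < N, ℓ j ≤ ε) ∧ ∑ j ∈ Finset.range N, ℓ j ≤ d g + ε ∧
      ∀ a b, a ≤ b → b ≤ N → d (h b - h a) ≤ 2 * D + ε + ∑ j ∈ Finset.Ico a b, ℓ j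

section Shares

variable {E : Type*} [AddCommGroup E]

/-- The sum of the steps `h (j + 1) - h j`, `j < k`, that are marked by `s`. -/
def markedSum (h : ℕ → E) (y : ℕ → ℤ) (s : ℤ) (k : ℕ) : E :=
  ∑ j ∈ (Finset.range k).filter (fun j => y j = s), (h (j + 1) - h j)

theorem markedSum_succ_of_eq (h : ℕ → E) (y : ℕ → ℤ) {s : ℤ} {k : ℕ} (hs : y k = s) :
    markedSum h y s (k + 1) = markedSum h y s k + (h (k + 1) - h k) := by
  rw [markedSum, Finset.range_add_one, Finset.filter_insert, if_pos hs,
    Finset.sum_insert (by simp), add_comm, markedSum]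

theorem markedSum_succ_of_ne (h : ℕ → E) (y : ℕ → ℤ) {s : ℤ} {k : ℕ} (hs : y k ≠ s) :
    markedSum h y s (k + 1) = markedSum h y s k := by
  rw [markedSum, Finset.range_add_one, Finset.filter_insert, if_neg hs, markedSum]

/-- Dividing a chain by `m` cuts and collecting the pieces into two shares costs at most `K` for
each of the `m + 1` pieces. -/
theorem markedSum_add_markedSum_le (d : AddGroupSeminorm E) (h : ℕ → E) (ℓ : ℕ → ℝ) (y : ℕ → ℤ)
    (hy : ∀ j, y j = 1 ∨ y j = -1) {K : ℝ} {N : ℕ} (hN : 0 < N)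
    (hd : ∀ a b, a ≤ b → b ≤ N → d (h b - h a) ≤ K + ∑ j ∈ Finset.Ico a b, ℓ j) :
    d (markedSum h y 1 N) + d (markedSum h y (-1) N) ≤
      K * (((Finset.range (N - 1)).filter fun j => y (j + 1) ≠ y j).card + 1) +
        ∑ j ∈ Finset.range N, ℓ j := by
  have hneg : ∀ j, y j ≠ -y j := by
    intro j
    rcases hy j with h | h <;> rw [h] <;> decide
  have close : ∀ (P : E) (a b : ℕ), a ≤ b → b ≤ N →
      d (P + (h b - h a)) + ∑ j ∈ Finset.range a, ℓ j ≤
        d P + K + ∑ j ∈ Finset.range b, ℓ j := by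
    intro P a b hab hb
    have h1 := map_add_le_add d P (h b - h a)
    have h2 := hd a b hab hb
    rw [← Finset.sum_range_add_sum_Ico ℓ hab]
    linarith
  -- Here `a` is the start of the piece still open and `P` the sum of the finished pieces of its
  -- share. A piece is paid for only when it is closed, so subadditivity is used once per piece.
  have key : ∀ m < N, ∃ a ≤ m, ∃ P, markedSum h y (y m) (m + 1) = P + (h (m + 1) - h a) ∧
      d P + d (markedSum h y (-y m) (m + 1)) ≤
        K * ((Finset.range m).filter fun j => y (j + 1) ≠ y j).card +
          ∑ j ∈ Finset.range a, ℓ j := by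
    intro m
    induction m with
    | zero =>
      intro _
      refine ⟨0, le_rfl, 0, ?_, ?_⟩
      · rw [markedSum_succ_of_eq h y rfl]; simp [markedSum]
      · rw [markedSum_succ_of_ne h y (hneg 0)]; simp [markedSum]
    | succ m ih =>
      intro hm
      obtain ⟨a, ham, P, hP, hle⟩ := ih (by omega)
      rw [Finset.range_add_one, Finset.filter_insert]
      by_cases hym : y (m + 1) = y m
      · refine ⟨a, by omega, P, ?_, ?_⟩
        · rw [markedSum_succ_of_eq h y rfl, hym, hP]; abel
        · rw [markedSum_succ_of_ne h y (hneg _), hym]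
          simpa using hle
      · have hyn : y (m + 1) = -y m := by
          have h1 := hy m
          have h2 := hy (m + 1)
          omega
        refine ⟨m + 1, le_rfl, markedSum h y (-y m) (m + 1), ?_, ?_⟩
        · rw [markedSum_succ_of_eq h y rfl, hyn]
        · rw [markedSum_succ_of_ne h y (hneg (m + 1)), hyn, neg_neg, hP, if_pos (hneg m).symm,
            Finset.card_insert_of_notMem (by simp)]
          have h1 := close P a (m + 1) (by omega) (by omega)
          push_cast
          linarith
  obtain ⟨a, ha, P, hP, hle⟩ := key (N - 1) (by omega)
  rw [Nat.sub_add_cancel hN] at hP hle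
  have h1 := close P a N (by omega) le_rfl
  rw [← hP] at h1
  have h2 : d (markedSum h y 1 N) + d (markedSum h y (-1) N) =
      d (markedSum h y (y (N - 1)) N) + d (markedSum h y (-y (N - 1)) N) := by
    rcases hy (N - 1) with h | h <;> rw [h]
    rw [neg_neg, add_comm]
  rw [h2]
  linarith

theorem markedSum_add_markedSum (h : ℕ → E) (y : ℕ → ℤ) (hy : ∀ j, y j = 1 ∨ y j = -1) (N : ℕ) :
    markedSum h y 1 N + markedSum h y (-1) N = h N - h 0 := by
  induction N with
  | zero => simp [markedSum]
  | succ N ih =>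
    rcases hy N with h1 | h1
    · rw [markedSum_succ_of_eq h y h1, markedSum_succ_of_ne h y (by rw [h1]; decide)]
      calc _ = (markedSum h y 1 N + markedSum h y (-1) N) + (h (N + 1) - h N) := by abel
        _ = _ := by rw [ih]; abel
    · rw [markedSum_succ_of_eq h y h1, markedSum_succ_of_ne h y (by rw [h1]; decide)]
      calc _ = (markedSum h y 1 N + markedSum h y (-1) N) + (h (N + 1) - h N) := by abel
        _ = _ := by rw [ih]; abel

theorem markedSum_sub_markedSum (h : ℕ → E) (y : ℕ → ℤ) (hy : ∀ j, y j = 1 ∨ y j = -1) (N : ℕ) :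
    markedSum h y 1 N - markedSum h y (-1) N =
      ∑ j ∈ Finset.range N, y j • (h (j + 1) - h j) := by
  induction N with
  | zero => simp [markedSum]
  | succ N ih =>
    rw [Finset.sum_range_succ, ← ih]
    rcases hy N with h1 | h1
    · rw [markedSum_succ_of_eq h y h1, markedSum_succ_of_ne h y (by rw [h1]; decide), h1, one_smul]
      abel
    · rw [markedSum_succ_of_eq h y h1, markedSum_succ_of_ne h y (by rw [h1]; decide), h1,
        neg_smul, one_smul]
      abel

end Shares

/-! ### The doubling inequality -/

section CoarselyGeodesic

variable {n : ℕ} {d : AddGroupSeminorm (Fin n → ℤ)} {D Ω : ℝ}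

theorem IsCoarselyGeodesic.exists_steps (hd : IsCoarselyGeodesic d D) {r : ℝ} (hr : 2 * D < r)
    (g : Fin n → ℤ) : ∃ (N : ℕ) (h : ℕ → Fin n → ℤ), h 0 = 0 ∧ h N = g ∧
      ∀ j < N, d (h (j + 1) - h j) ≤ r := by
  obtain ⟨N, -, h, ℓ, h0, hN, hℓ, -, hstep⟩ := hd g ((r - 2 * D) / 2) (by linarith) 0
  refine ⟨N, h, h0, hN, fun j hj => ?_⟩
  have h1 := hstep j (j + 1) (by omega) (by omega)
  rw [Nat.Ico_succ_singleton, Finset.sum_singleton] at h1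
  have h2 := hℓ j hj
  linarith

/-- The balls of radius `r > 2 D` are finite, and there is a sublattice of small index with respect
to which their elements have small coordinates. -/
theorem IsCoarselyGeodesic.exists_matrix (hn : 1 ≤ n) (hd : IsCoarselyGeodesic d D)
    (hvol : HasLowerVolumeBound d Ω) {r : ℝ} (hr0 : 0 < r) (hr : 2 * D < r) :
    ∃ S : Finset (Fin n → ℤ), (∀ s, s ∈ S ↔ d s ≤ r) ∧ (S.card : ℝ) ≤ (5 * n * r) ^ n * Ω ∧
      ∃ A : Matrix (Fin n) (Fin n) ℤ, A.det ≠ 0 ∧ (∀ i, d (A.col i) ≤ r) ∧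
        (∀ s, d s ≤ r → ∀ i, |A.cramer s i| ≤ |A.det|) ∧
        Finite ((Fin n → ℤ) ⧸ columnLattice A) ∧
        (Nat.card ((Fin n → ℤ) ⧸ columnLattice A) : ℝ) ≤ (n * r) ^ n * Ω := by
  classical
  obtain ⟨A₀, hA₀, hA₀r⟩ := exists_det_ne_zero {s | d s ≤ r} (hd.exists_steps hr)
  let F₀ : Finset (Fin n → ℤ) := Finset.univ.image fun i => A₀.col i
  have hF₀ : ∀ s ∈ F₀, d s ≤ r := by
    intro s hs
    obtain ⟨i, -, rfl⟩ := Finset.mem_image.1 hs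
    exact hA₀r i
  have main : ∀ F : Finset (Fin n → ℤ), F₀ ⊆ F → (∀ s ∈ F, d s ≤ r) →
      (F.card : ℝ) ≤ (5 * n * r) ^ n * Ω ∧
      ∃ A : Matrix (Fin n) (Fin n) ℤ, A.det ≠ 0 ∧ (∀ i, d (A.col i) ≤ r) ∧
        (∀ s ∈ F, ∀ i, |A.cramer s i| ≤ |A.det|) ∧
        Finite ((Fin n → ℤ) ⧸ columnLattice A) ∧
        (Nat.card ((Fin n → ℤ) ⧸ columnLattice A) : ℝ) ≤ (n * r) ^ n * Ω := by
    intro F hF hFr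
    obtain ⟨A, hA, hAF, hcr⟩ := exists_cramer_le F
      ⟨A₀, hA₀, fun i => hF (Finset.mem_image_of_mem _ (Finset.mem_univ i))⟩
    obtain ⟨hfin, hq⟩ := card_quotient_columnLattice_le hn hvol hA hr0 fun i => hFr _ (hAF i)
    refine ⟨?_, A, hA, fun i => hFr _ (hAF i), hcr, hfin, hq⟩
    have h1 := card_le_mul_card_quotient hA F hcr
    calc (F.card : ℝ) ≤ 5 ^ n * (Nat.card ((Fin n → ℤ) ⧸ columnLattice A) : ℝ) := by
          exact_mod_cast h1
      _ ≤ 5 ^ n * ((n * r) ^ n * Ω) := by gcongr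
      _ = _ := by rw [mul_assoc 5, mul_pow 5]; ring
  have hfin : {s : Fin n → ℤ | d s ≤ r}.Finite := by
    by_contra hinf
    obtain ⟨F, hF, hFcard⟩ := Set.Infinite.exists_subset_card_eq hinf
      (⌊(5 * n * r) ^ n * Ω⌋₊ + 1)
    have h1 := (main (F₀ ∪ F) Finset.subset_union_left (by
      intro s hs
      rcases Finset.mem_union.1 hs with hs | hs
      · exact hF₀ s hs
      · exact hF hs)).1
    have h2 : (F.card : ℝ) ≤ (F₀ ∪ F).card := by
      exact_mod_cast Finset.card_le_card Finset.subset_union_right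
    have h3 := Nat.lt_floor_add_one ((5 * n * r) ^ n * Ω)
    rw [hFcard] at h2
    push_cast at h2
    linarith
  obtain ⟨h1, A, hA, hAr, hcr, hfinA, hq⟩ := main hfin.toFinset
    (fun s hs => by simpa using hF₀ s hs) (fun s hs => by simpa using hs)
  exact ⟨hfin.toFinset, fun s => by simp, h1, A, hA, hAr,
    fun s hs => hcr s (by simpa using hs), hfinA, hq⟩

/-- If `D ≤ 0`, every radius `r > 0` is admissible. The ball contains the origin, so `1 ≤ (5 n r) ^
n Ω`, which fails for small `r`. -/
theorem IsCoarselyGeodesic.pos (hn : 1 ≤ n) (hd : IsCoarselyGeodesic d D)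
    (hvol : HasLowerVolumeBound d Ω) : 0 < D := by
  by_contra hD
  have hn0 : (0 : ℝ) < n := by exact_mod_cast hn
  have key : ∀ r : ℝ, 0 < r → 1 ≤ (5 * n * r) ^ n * Ω := by
    intro r hr
    obtain ⟨S, hS, hcard, -⟩ := hd.exists_matrix hn hvol hr (by linarith)
    have h1 : 0 < S.card := Finset.card_pos.2 ⟨0, (hS 0).2 (by simpa using hr.le)⟩
    have h2 : (1 : ℝ) ≤ S.card := by exact_mod_cast h1
    linarith
  have hΩ : 0 < Ω := by
    by_contra h
    have h1 := key 1 one_pos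
    have h2 : (5 * n * 1 : ℝ) ^ n * Ω ≤ 0 := mul_nonpos_of_nonneg_of_nonpos (by positivity)
      (not_lt.1 h)
    linarith
  have h1 := key (1 / (5 * n * (Ω + 1))) (by positivity)
  have h2 : 5 * n * (1 / (5 * n * (Ω + 1))) = 1 / (Ω + 1) := by field_simp
  rw [h2] at h1
  have h3 : (1 / (Ω + 1)) ^ n ≤ 1 / (Ω + 1) :=
    pow_le_of_le_one (by positivity) (by rw [div_le_one (by positivity)]; linarith) (by omega)
  have h4 : (1 / (Ω + 1)) ^ n * Ω ≤ 1 / (Ω + 1) * Ω := by gcongr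
  have h5 : 1 / (Ω + 1) * Ω < 1 := by
    rw [one_div, inv_mul_lt_one₀ (by positivity)]
    linarith
  linarith

theorem IsCoarselyGeodesic.volume_pos (hn : 1 ≤ n) (hd : IsCoarselyGeodesic d D)
    (hvol : HasLowerVolumeBound d Ω) : 0 < Ω := by
  have hD := hd.pos hn hvol
  obtain ⟨S, hS, hcard, -⟩ :=
    hd.exists_matrix hn hvol (r := 3 * D) (by linarith) (by linarith)
  have h1 : 0 < S.card := Finset.card_pos.2 ⟨0, (hS 0).2 (by rw [map_zero]; positivity)⟩
  have h2 : (0 : ℝ) < S.card := by exact_mod_cast h1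
  exact pos_of_mul_pos_right (h2.trans_le hcard) (by positivity)

theorem IsCoarselyGeodesic.two_mul_le (hn : 1 ≤ n) (hd : IsCoarselyGeodesic d D)
    (hvol : HasLowerVolumeBound d Ω) (γ : Fin n → ℤ) :
    2 * d γ ≤ d (2 • γ) + 24 * n * (15 * n) ^ n * (Ω * D ^ n) * D := by
  classical
  have hD := hd.pos hn hvol
  obtain ⟨S, hS, hcard, A, hA, hAr, hcr, hfin, hq⟩ :=
    hd.exists_matrix hn hvol (r := 3 * D) (by linarith) (by linarith)
  have hS0 : (0 : Fin n → ℤ) ∈ S := (hS 0).2 (by rw [map_zero]; positivity)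
  have hsteps := hd.exists_steps (r := 3 * D) (by linarith)
  set t := S.card with ht
  set q := Nat.card ((Fin n → ℤ) ⧸ columnLattice A) with hqdef
  -- With `ε = D / 2` each step has seminorm at most `2 D + D / 2 + D / 2 = 3 D`, and `t + 1` beads
  -- suffice for the splitting.
  obtain ⟨N, hN, h, ℓ, h0, hNγ, hℓ, hsum, hdist⟩ := hd (2 • γ) (D / 2) (by positivity) (t + 1)
  have hstep : ∀ j < N, h (j + 1) - h j ∈ S := by
    intro j hj
    rw [hS]
    have h1 := hdist j (j + 1) (by omega) (by omega)
    rw [Nat.Ico_succ_singleton, Finset.sum_singleton] at h1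
    have h2 := hℓ j hj
    linarith
  let c : ℕ → S := fun j => if hj : j < N then ⟨_, hstep j hj⟩ else ⟨0, hS0⟩
  have : Nonempty S := ⟨⟨0, hS0⟩⟩
  obtain ⟨y, hy, hcuts, hbal⟩ := exists_balanced_splitting N c (by
    rw [Fintype.card_coe]; omega)
  rw [Fintype.card_coe, ← ht] at hcuts hbal
  have hshare := markedSum_add_markedSum_le d h ℓ y hy (by omega) hdist
  have hadd := markedSum_add_markedSum h y hy N
  have hsub := markedSum_sub_markedSum h y hy N
  set P := markedSum h y 1 N
  set M := markedSum h y (-1) N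
  rw [h0, sub_zero, hNγ] at hadd
  have hcoord : ∀ i, |A.cramer (2 • (P - γ)) i| ≤ 2 * t * |A.det| := by
    intro i
    have h1 : 2 • (P - γ) = P - M := by
      rw [smul_sub, ← hadd, two_smul]
      abel
    have h2 : P - M = ∑ s : S, (∑ j ∈ (Finset.range N).filter (fun j => c j = s), y j) • s.1 := by
      rw [hsub, ← Finset.sum_fiberwise (Finset.range N) c]
      refine Finset.sum_congr rfl fun s _ => ?_
      rw [Finset.sum_smul]
      refine Finset.sum_congr rfl fun j hj => ?_
      rw [Finset.mem_filter, Finset.mem_range] at hj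
      rw [← hj.2]
      simp only [c, dif_pos hj.1]
    rw [h1, h2, map_sum, Finset.sum_apply]
    refine (Finset.abs_sum_le_sum_abs _ _).trans ?_
    calc _ ≤ ∑ s : S, |∑ j ∈ (Finset.range N).filter (fun j => c j = s), y j| * |A.det| := by
          refine Finset.sum_le_sum fun s _ => ?_
          rw [map_zsmul, Pi.smul_apply, smul_eq_mul, abs_mul]
          exact mul_le_mul_of_nonneg_left (hcr s.1 ((hS _).1 s.2) i) (abs_nonneg _)
      _ = (∑ s : S, |∑ j ∈ (Finset.range N).filter (fun j => c j = s), y j|) * |A.det| := by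
          rw [Finset.sum_mul]
      _ ≤ _ := mul_le_mul_of_nonneg_right hbal (abs_nonneg _)
  have hδ := seminorm_le_of_cramer_two_smul_le hA (by positivity) hAr hsteps hcr (P - γ) t hcoord
  rw [← hqdef] at hδ
  have hP : d γ ≤ d P + d (P - γ) := by
    have h1 := map_sub_le_add d P (P - γ)
    rwa [sub_sub_cancel] at h1
  have hM : d γ ≤ d M + d (P - γ) := by
    have h1 := map_add_le_add d M (P - γ)
    have h2 : M + (P - γ) = γ := by
      have h3 : M = 2 • γ - P := by rw [← hadd]; abel
      rw [h3, two_smul]; abel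
    rwa [h2] at h1
  have hn1 : (1 : ℝ) ≤ n := by exact_mod_cast hn
  -- `B` is the bound for `S.card` at `r = 3 D`; it also dominates `q` and the number of cuts.
  set B : ℝ := (15 * n) ^ n * (Ω * D ^ n) with hB
  have htB : (t : ℝ) ≤ B := by
    refine hcard.trans (le_of_eq ?_)
    have h1 : (5 * n * (3 * D)) ^ n = (15 * n) ^ n * D ^ n := by rw [← mul_pow]; ring
    rw [hB, h1]
    ring
  have ht1 : (1 : ℝ) ≤ t := by
    exact_mod_cast Finset.card_pos.2 ⟨0, hS0⟩
  have hB1 : 1 ≤ B := ht1.trans htB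
  have hΩ := hd.volume_pos hn hvol
  have hqB : (q : ℝ) ≤ B := by
    refine hq.trans ?_
    have h1 : (n * (3 * D)) ^ n = (3 * n) ^ n * D ^ n := by rw [← mul_pow]; ring
    have h2 : (3 * n : ℝ) ^ n ≤ (15 * n) ^ n := by gcongr; norm_num
    rw [h1, hB, mul_assoc, mul_comm (D ^ n) Ω]
    gcongr
  have hcutsR : (((Finset.range (N - 1)).filter fun j => y (j + 1) ≠ y j).card : ℝ) ≤ B :=
    le_trans (by exact_mod_cast hcuts) htB
  have hshare' : d P + d M ≤ (2 * D + D / 2) * (B + 1) + (d (2 • γ) + D / 2) := by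
    refine hshare.trans ?_
    gcongr
  have hδ' : d (P - γ) ≤ (n * (B + B) + B) * (3 * D) := by
    refine hδ.trans ?_
    gcongr
  have hBD : D ≤ B * D := by nlinarith
  have hnBD : B * D ≤ n * (B * D) := by
    have : 0 ≤ B * D := by positivity
    nlinarith
  -- The excess is at most `5/2 + 3 + 12 + 6 < 24` times `n B D`, since `D ≤ B D ≤ n B D`.
  have hgoal : 24 * n * (15 * n) ^ n * (Ω * D ^ n) * D = 24 * (n * (B * D)) := by
    rw [hB]; ring
  rw [hgoal]
  have e1 : (2 * D + D / 2) * (B + 1) = 5 / 2 * (B * D) + 5 / 2 * D := by ring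
  have e2 : (n * (B + B) + B) * (3 * D) = 6 * (n * (B * D)) + 3 * (B * D) := by ring
  rw [e1] at hshare'
  rw [e2] at hδ'
  linarith

end CoarselyGeodesic

/-! ### From the action on a length space to the lattice -/

theorem exists_dist_smul_lt {Γ X : Type*} [Group Γ] [MetricSpace X] [MulAction Γ X] {D : ℝ}
    (hD : codiameter Γ X ≤ ENNReal.ofReal D) (x y : X) {ε : ℝ} (hε : 0 < ε) : ∃ γ : Γ, dist x (γ • y) < max D 0 + ε := by
  have h1 : Metric.infEDist x (MulAction.orbit Γ y) < ENNReal.ofReal (max D 0 + ε) := by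
    refine lt_of_le_of_lt ((le_iSup₂ (f := fun x y : X =>
      Metric.infEDist x (MulAction.orbit Γ y)) x y).trans hD) ?_
    rw [ENNReal.ofReal_lt_ofReal_iff (by positivity)]
    linarith [le_max_left D 0]
  obtain ⟨_, ⟨γ, rfl⟩, hγ⟩ := Metric.infEDist_lt_iff.1 h1
  refine ⟨γ, ?_⟩
  rw [edist_dist, ENNReal.ofReal_lt_ofReal_iff (by positivity)] at hγ
  exact hγ

section Action

variable {Γ X : Type*} [Group Γ] [MetricSpace X] [MulAction Γ X] [IsIsometricSMul Γ X]

theorem dist_smul_pow_le (x : X) (γ : Γ) (k : ℕ) :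
    dist x (γ ^ k • x) ≤ k * dist x (γ • x) := by
  induction k with
  | zero => simp
  | succ k ih =>
    have h1 := dist_triangle x (γ ^ k • x) (γ ^ (k + 1) • x)
    rw [pow_succ, mul_smul, dist_smul] at h1
    rw [pow_succ, mul_smul]
    push_cast
    linarith

/-- If doubling the translation doubles the displacement up to `C`, then the displacement differs
from the stable norm by at most `C`. -/
theorem abs_dist_sub_stableNorm_le (x : X) {C : ℝ} (hC0 : 0 ≤ C)
    (hC : ∀ γ : Γ, 2 * dist x (γ • x) ≤ dist x (γ ^ 2 • x) + C) (γ : Γ) :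
    |dist x (γ • x) - stableNorm x γ| ≤ C := by
  have hlim := tendsto_stableNorm x γ
  have hle : stableNorm x γ ≤ dist x (γ • x) := by
    refine le_of_tendsto' hlim fun k => ?_
    exact div_le_of_le_mul₀ (Nat.cast_nonneg _) dist_nonneg
      (by rw [mul_comm]; exact dist_smul_pow_le x γ k)
  -- Subtracting `C` turns the hypothesis into exact superdoubling, which iterates without further
  -- loss.
  have hpow : ∀ k : ℕ, 2 ^ k * (dist x (γ • x) - C) ≤ dist x (γ ^ 2 ^ k • x) - C := by
    intro k
    induction k with
    | zero => simp
    | succ k ih =>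
      have h1 := hC (γ ^ 2 ^ k)
      rw [← pow_mul, ← pow_succ] at h1
      rw [pow_succ]
      linarith
  have hge : dist x (γ • x) - C ≤ stableNorm x γ := by
    have hsub := hlim.comp (tendsto_pow_atTop_atTop_of_one_lt (one_lt_two (α := ℕ)))
    refine ge_of_tendsto' hsub fun k => ?_
    simp only [Function.comp_apply]
    rw [le_div_iff₀ (by positivity)]
    have h1 := hpow k
    push_cast
    linarith
  rw [abs_le]
  constructor <;> linarith

variable {n : ℕ} (e : Γ ≃* Multiplicative (Fin n → ℤ))

/-- The displacement of a base point as a seminorm on the lattice that acts. -/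
noncomputable def displacement (x : X) : AddGroupSeminorm (Fin n → ℤ) where
  toFun g := dist x (e.symm (Multiplicative.ofAdd g) • x)
  map_zero' := by simp
  add_le' g h := by
    rw [ofAdd_add, map_mul, mul_smul]
    refine (dist_triangle _ (e.symm (Multiplicative.ofAdd g) • x) _).trans ?_
    rw [dist_smul]
  neg' g := by
    rw [ofAdd_neg, map_inv, ← dist_smul (e.symm (Multiplicative.ofAdd g)), smul_inv_smul,
      dist_comm]

theorem displacement_apply (x : X) (g : Fin n → ℤ) :
    displacement e x g = dist x (e.symm (Multiplicative.ofAdd g) • x) := rfl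

theorem displacement_sub (x : X) (g h : Fin n → ℤ) :
    displacement e x (g - h) =
      dist (e.symm (Multiplicative.ofAdd h) • x) (e.symm (Multiplicative.ofAdd g) • x) := by
  rw [displacement_apply, ← dist_smul (e.symm (Multiplicative.ofAdd h)), ← mul_smul, ← map_mul,
    ← ofAdd_add, add_sub_cancel]

/-- A short path in a length space, subdivided finely. -/
theorem IsLengthSpace.exists_chain (hX : IsLengthSpace X) (x y : X) {ε : ℝ} (hε : 0 < ε)
    (N₀ : ℕ) : ∃ N ≥ N₀, 0 < N ∧ ∃ z : ℕ → X, z 0 = x ∧ z N = y ∧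
      (∀ j, dist (z j) (z (j + 1)) ≤ ε) ∧
      ∑ j ∈ Finset.range N, dist (z j) (z (j + 1)) ≤ dist x y + ε := by
  have h1 : edist x y < ENNReal.ofReal (dist x y + ε) := by
    rw [edist_dist, ENNReal.ofReal_lt_ofReal_iff (by positivity)]
    linarith
  rw [hX x y, iInf_lt_iff] at h1
  obtain ⟨p, hp⟩ := h1
  have huc : UniformContinuous p :=
    CompactSpace.uniformContinuous_of_continuous p.continuous
  obtain ⟨δ, hδ, hpδ⟩ := Metric.uniformContinuous_iff.1 huc ε hε
  obtain ⟨m, hm⟩ := exists_nat_one_div_lt hδ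
  set N := max N₀ (m + 1) with hN
  have hNpos : 0 < N := lt_of_lt_of_le (Nat.succ_pos m) (le_max_right _ _)
  have hNR : (0 : ℝ) < N := by exact_mod_cast hNpos
  let u : ℕ → unitInterval := fun j => Set.projIcc (0 : ℝ) 1 zero_le_one (j / N)
  have hu : Monotone u := by
    intro i j hij
    refine Set.monotone_projIcc _ ?_
    gcongr
  have hu0 : u 0 = 0 := by
    simp only [u, Nat.cast_zero, zero_div]
    exact Set.projIcc_left _
  have huN : u N = 1 := by
    simp only [u, div_self hNR.ne']
    exact Set.projIcc_right _
  have hustep : ∀ j, dist (u j) (u (j + 1)) < δ := by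
    intro j
    have h2 : dist (u j) (u (j + 1)) ≤ dist ((j : ℝ) / N) ((j + 1 : ℕ) / N) :=
      (LipschitzWith.projIcc (zero_le_one (α := ℝ))).dist_le_mul _ _ |>.trans (by simp)
    have h3 : dist ((j : ℝ) / N) ((j + 1 : ℕ) / N) = 1 / N := by
      rw [dist_comm, Real.dist_eq, ← sub_div]
      push_cast
      rw [add_sub_cancel_left, abs_of_pos (by positivity)]
    have h4 : (1 : ℝ) / N ≤ 1 / (m + 1) := by
      have : ((m + 1 : ℕ) : ℝ) ≤ N := by exact_mod_cast le_max_right _ _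
      push_cast at this
      gcongr
    linarith
  refine ⟨N, le_max_left _ _, hNpos, fun j => p (u j), by simp [hu0], by simp [huN],
    fun j => (hpδ (hustep j)).le, ?_⟩
  have h5 := (eVariationOn.sum_le (f := p) (n := N) hu fun i => Set.mem_univ (u i)).trans hp.le
  simp_rw [edist_dist] at h5
  rw [← ENNReal.ofReal_sum_of_nonneg (fun _ _ => dist_nonneg),
    ENNReal.ofReal_le_ofReal_iff (by positivity)] at h5
  refine le_trans (le_of_eq (Finset.sum_congr rfl fun j _ => dist_comm _ _)) h5

/-- Each point of a subdivided short path is moved to an orbit point within `D + ε / 2`; for a part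
of the chain this is paid only at its two ends. -/
theorem isCoarselyGeodesic_displacement (hX : IsLengthSpace X) {D : ℝ}
    (hD : codiameter Γ X ≤ ENNReal.ofReal D) (x : X) :
    IsCoarselyGeodesic (displacement e x) (max D 0) := by
  intro g ε hε N₀
  obtain ⟨N, hN, hNpos, z, hz0, hzN, hz, hsum⟩ :=
    hX.exists_chain x (e.symm (Multiplicative.ofAdd g) • x) hε N₀
  have hnear : ∀ j, ∃ h : Fin n → ℤ,
      dist (z j) (e.symm (Multiplicative.ofAdd h) • x) ≤ max D 0 + ε / 2 ∧
        (j = 0 → h = 0) ∧ (j = N → h = g) := by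
    intro j
    rcases eq_or_ne j 0 with rfl | hj0
    · refine ⟨0, ?_, fun _ => rfl, fun h => absurd h hNpos.ne⟩
      rw [hz0]
      simp only [ofAdd_zero, map_one, one_smul, dist_self]
      positivity
    rcases eq_or_ne j N with rfl | hjN
    · refine ⟨g, ?_, fun h => absurd h hj0, fun _ => rfl⟩
      rw [hzN, dist_self]
      positivity
    · obtain ⟨γ, hγ⟩ := exists_dist_smul_lt hD (z j) x (half_pos hε)
      refine ⟨Multiplicative.toAdd (e γ), ?_, fun h => absurd h hj0, fun h => absurd h hjN⟩
      simpa using hγ.le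
  choose h hh hh0 hhN using hnear
  refine ⟨N, hN, h, fun j => dist (z j) (z (j + 1)), hh0 0 rfl, hhN N rfl, fun j _ => hz j, hsum,
    fun a b hab _ => ?_⟩
  rw [displacement_sub]
  have h1 := dist_triangle4 (e.symm (Multiplicative.ofAdd (h a)) • x) (z a) (z b)
    (e.symm (Multiplicative.ofAdd (h b)) • x)
  have h2 := dist_le_Ico_sum_dist z hab
  have h3 := hh a
  have h4 := hh b
  rw [dist_comm] at h3
  linarith

theorem hasLowerVolumeBound_displacement {Ω : ℝ} (x x₁ : X)
    (hΩ : asymptoticVolume Γ n x₁ ≤ ENNReal.ofReal Ω) :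
    HasLowerVolumeBound (displacement e x) (max Ω 0) := by
  -- Changing the base point changes displacements by at most `2 * dist x x₁`.
  refine ⟨2 * dist x x₁, fun c hc R₀ => ?_⟩
  have hc0 : 0 < c := lt_of_le_of_lt (le_max_right _ _) hc
  have h1 : asymptoticVolume Γ n x₁ < ENNReal.ofReal c := by
    refine hΩ.trans_lt ?_
    rw [ENNReal.ofReal_lt_ofReal_iff hc0]
    exact lt_of_le_of_lt (le_max_left _ _) hc
  have h2 := frequently_lt_of_liminf_lt (by isBoundedDefault) h1
  obtain ⟨R, hR, hRlt⟩ := (frequently_atTop.1 h2) (max R₀ 0 + 1)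
  have hR0 : R₀ < R := by linarith [le_max_left R₀ 0]
  have hRpos : 0 < R := by linarith [le_max_right R₀ 0]
  refine ⟨R, hR0, fun T hT => ?_⟩
  classical
  have hinj : Function.Injective fun g : Fin n → ℤ => e.symm (Multiplicative.ofAdd g) :=
    e.symm.injective.comp Multiplicative.ofAdd.injective
  have hsub : ((T.image fun g => e.symm (Multiplicative.ofAdd g) : Finset Γ) : Set Γ) ⊆
      {γ : Γ | dist x₁ (γ • x₁) < R} := by
    intro γ hγ
    obtain ⟨g, hg, rfl⟩ := Finset.mem_image.1 (Finset.mem_coe.1 hγ)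
    have h3 := hT g hg
    rw [displacement_apply] at h3
    have h4 := dist_triangle4 x₁ x (e.symm (Multiplicative.ofAdd g) • x)
      (e.symm (Multiplicative.ofAdd g) • x₁)
    rw [dist_smul, dist_comm x₁ x] at h4
    change dist x₁ (e.symm (Multiplicative.ofAdd g) • x₁) < R
    linarith
  have hcard := Set.encard_le_encard hsub
  rw [Set.encard_coe_eq_coe_finsetCard, Finset.card_image_of_injective _ hinj] at hcard
  have hcard' : ((T.card : ℕ∞) : ℝ≥0∞) ≤ (({γ : Γ | dist x₁ (γ • x₁) < R}.encard : ℕ∞) : ℝ≥0∞) :=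
    ENat.toENNReal_le.2 hcard
  have hRn : ENNReal.ofReal R ^ n = ENNReal.ofReal (R ^ n) := (ENNReal.ofReal_pow hRpos.le n).symm
  rw [hRn, ENNReal.div_lt_iff (Or.inl (by simp; positivity)) (Or.inl ENNReal.ofReal_ne_top),
    ← ENNReal.ofReal_mul hc0.le] at hRlt
  have h5 := hcard'.trans hRlt.le
  rw [ENat.toENNReal_coe, ← ENNReal.ofReal_natCast,
    ENNReal.ofReal_le_ofReal_iff (by positivity)] at h5
  exact h5

end Action

/-! ### The constant and the conclusion -/

/-- The main point is `15 n ≤ 2 ^ 6 * 2 ^ n`; strictness comes from `u < u + 1`. -/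
theorem constant_lt {n : ℕ} (hn : 1 ≤ n) {D u : ℝ} (hD : 0 < D) (hu : 0 ≤ u) :
    24 * n * (15 * n) ^ n * u * D <
      2 ^ (n ^ 2 + 6 * n + 10) * (n : ℝ) ^ 2 * (n ! : ℝ) ^ (n + 2) * D * (u + 1) ^ (n + 4) := by
  have hn1 : (1 : ℝ) ≤ n := by exact_mod_cast hn
  have h1 : (24 : ℝ) ≤ 2 ^ 10 := by norm_num
  have h2 : (15 * n : ℝ) ^ n ≤ 2 ^ (n ^ 2 + 6 * n) := by
    have h3 : (n : ℝ) ≤ 2 ^ n := by exact_mod_cast Nat.lt_two_pow_self.le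
    have h4 : (2 : ℝ) ^ (n ^ 2 + 6 * n) = (2 ^ 6 * 2 ^ n) ^ n := by
      rw [mul_pow, ← pow_mul, ← pow_mul, ← pow_add]
      congr 1
      ring
    rw [h4]
    gcongr
    norm_num
  have h5 : (n : ℝ) ≤ (n : ℝ) ^ 2 := le_self_pow₀ hn1 (by norm_num)
  have h6 : (1 : ℝ) ≤ (n ! : ℝ) ^ (n + 2) :=
    one_le_pow₀ (by exact_mod_cast Nat.one_le_iff_ne_zero.2 n.factorial_ne_zero)
  have h7 : u + 1 ≤ (u + 1) ^ (n + 4) := le_self_pow₀ (by linarith) (by omega)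
  calc 24 * n * (15 * n) ^ n * u * D
      = (24 * (15 * n) ^ n) * n * 1 * D * u := by ring
    _ ≤ (2 ^ 10 * 2 ^ (n ^ 2 + 6 * n)) * (n : ℝ) ^ 2 * (n ! : ℝ) ^ (n + 2) * D * u := by gcongr
    _ = 2 ^ (n ^ 2 + 6 * n + 10) * (n : ℝ) ^ 2 * (n ! : ℝ) ^ (n + 2) * D * u := by
        rw [pow_add 2 _ 10]; ring
    _ < 2 ^ (n ^ 2 + 6 * n + 10) * (n : ℝ) ^ 2 * (n ! : ℝ) ^ (n + 2) * D * (u + 1) ^ (n + 4) := by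
        refine mul_lt_mul_of_pos_left (by linarith) ?_
        have : (0 : ℝ) < n ! := by exact_mod_cast n.factorial_pos
        positivity

theorem mainTheorem1 {Γ X : Type*} [Group Γ] [MetricSpace X] [MulAction Γ X]
    [IsIsometricSMul Γ X] [ProperlyDiscontinuousSMul Γ X]
    [CompactSpace (MulAction.orbitRel.Quotient Γ X)]
    (hX : IsLengthSpace X)
    (hfree : ∀ (γ : Γ) (x : X), γ • x = x → γ = 1)
    (n : ℕ) (hn : 1 ≤ n) (e : Γ ≃* Multiplicative (Fin n → ℤ))
    (D Ω : ℝ) (hD : codiameter Γ X ≤ ENNReal.ofReal D)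
    (x₁ : X) (hΩ : asymptoticVolume Γ n x₁ ≤ ENNReal.ofReal Ω)
    (γ : Γ) (x₀ : X) :
    |dist x₀ (γ • x₀) - stableNorm x₀ γ| <
      2 ^ (n ^ 2 + 6 * n + 10) * (n : ℝ) ^ 2 * (n ! : ℝ) ^ (n + 2) * D *
        (Ω * D ^ n + 1) ^ (n + 4) := by
  have hgeo := isCoarselyGeodesic_displacement e hX hD x₀
  have hvol := hasLowerVolumeBound_displacement e x₀ x₁ hΩ
  -- Positivity is a consequence of the geometry; it removes the truncations `max D 0` and `max Ω
  -- 0`.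
  have hDpos : 0 < D := by simpa using hgeo.pos hn hvol
  have hΩpos : 0 < Ω := by simpa using hgeo.volume_pos hn hvol
  rw [max_eq_left hDpos.le] at hgeo
  rw [max_eq_left hΩpos.le] at hvol
  refine lt_of_le_of_lt (abs_dist_sub_stableNorm_le x₀ (by positivity) (fun γ => ?_) γ)
    (constant_lt hn hDpos (by positivity))
  have h := hgeo.two_mul_le hn hvol (Multiplicative.toAdd (e γ))
  rw [displacement_apply, displacement_apply, ofAdd_nsmul, map_pow] at h
  simpa using h
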